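/- Let $N_T,N_R,N_t\ge 1$ be integers, $[L]=\{1,\dots,L\}$, $e(x)=e^{2\pi \mathrm{i} x}$, $d_T=\tfrac12$, $d_R=\tfrac{N_T}{2}$, $\Delta_\beta=\tfrac{2}{N_TN_R}$, and $\mathcal G=[N_TN_R]\times[N_t]\times[N_t]$. For $\boldsymbol s\in\mathbb C^{N_t}$ put $[T_\tau \boldsymbol s]_k=[\boldsymbol s]_{k-\tau}$ (indices modulo $N_t$) and $[M_f \boldsymbol s]_k=e\big(\tfrac{f}{N_t}(k-1)\big)[\boldsymbol s]_k$. Let $\boldsymbol s_1,\dots,\boldsymbol s_{N_T}$ be independent standard complex Gaussian random vectors in $\mathbb C^{N_t}$ (their entries are independent, each distributed as $x+\mathrm{i}y$ with independent $x,y\sim N(0,\tfrac12)$). Let $\widetilde A=\frac{1}{\sqrt{N_TN_RN_t}}A\in\mathbb C^{N_RN_t\times|\mathcal G|}$, where the column of $A$ with index $\Theta=(\beta,\tau,f)\in\mathcal G$ is the concatenation over $j=1,\dots,N_R$ of the vectors $$A^j_\Theta=e\big(d_R\beta\Delta_\beta(j-1)\big)\sum_{i=1}^{N_T}e\big(d_T\beta\Delta_\beta(i-1)\big)M_fT_\tau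 \boldsymbol s_i\in\mathbb C^{N_t}.$$ For $S\subset\mathcal G$ let $\widetilde A_S$ be the submatrix of the columns with index in $S$. Angle parameters $\beta,\beta'\in[N_TN_R]$ are equivalent, $\beta\sim\beta'$, if $\beta'-\beta\in N_R\mathbb Z$; the classes $[\beta]$ are called angle classes, and $S_{[\beta]}=\{(\beta',\tau',f')\in S:\beta'\sim\beta\}$. The set $S$ is called $\eta$-balanced if $\eta$ is the smallest real number such that $|S_{[\beta]}|\le\eta|S|/N_R$ for all angle classes $[\beta]$ (this presupposes $S\neq\emptyset$). Let $\|\cdot\|_{2\to2}$ be the spectral norm. **Proposition.** 1. For all $S\subset\mathcal G$, all angle classes $[\beta]$ with $S_{[\beta]}\ne\emptyset$ and all $\delta\in(0,1)$, $$\mathbb P\big(\|\widetilde A_{S_{[\beta]}}^*\widetilde A_{S_{[\beta]}}-\mathrm{Id}\|_{2\to2}\ge\delta\big)\le 7|S_{[\beta]}|\exp\Big(-\frac{\delta\sqrt{N_t}}{8\sqrt{|S_{[\beta]}|}}\Big).$$ 2. For all $S\subset\mathcal G$ and every realization of the signals, $\widetilde A_S^*\widetilde A_S$ is block diagonal with respect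 to the angle classes, that is, $[\widetilde A_S^*\widetilde A_S]_{\Theta,\Theta'}=0$ for all $\Theta,\Theta'\in S$ whose angle parameters are not equivalent, and $$\|\widetilde A_S^*\widetilde A_S-\mathrm{Id}\|_{2\to2}=\max_{[\beta]}\|\widetilde A_{S_{[\beta]}}^*\widetilde A_{S_{[\beta]}}-\mathrm{Id}\|_{2\to2}$$ (the norm of an empty matrix being $0$). 3. For all $\eta$-balanced $S\subset\mathcal G$ and all $\delta\in(0,1)$, $$\mathbb P\big(\|\widetilde A_S^*\widetilde A_S-\mathrm{Id}\|_{2\to2}\ge\delta\big)\le 7\eta|S|\exp\Big(-\frac{\delta\sqrt{N_tN_R}}{8\sqrt{\eta|S|}}\Big).$$ -/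

import Mathlib

open MeasureTheory ProbabilityTheory
open scoped NNReal

noncomputable section

namespace MimoRadar

/-- The unit-modulus phase `e(x) = exp(2 π i x)`. -/
def phase (x : ℝ) : ℂ := Complex.exp (2 * Real.pi * Complex.I * x)

/-- The grid `[NT * NR] × [Nt] × [Nt]` of (angle, delay, Doppler) parameters. The element `k` of
`Fin L` represents the integer `k + 1` of `[L] = {1, …, L}`. -/
abbrev Grid (NT NR Nt : ℕ) : Type := Fin (NT * NR) × Fin Nt × Fin Nt

/-- The transmit antenna spacing (in wavelengths). -/
def dT : ℝ := 1 / 2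

/-- The receive antenna spacing (in wavelengths). -/
def dR (NT : ℕ) : ℝ := (NT : ℝ) / 2

/-- The angular step size. -/
def stepAngle (NT NR : ℕ) : ℝ := 2 / ((NT : ℝ) * (NR : ℝ))

/-- The circulant shift `[T_τ s]_k = [s]_{k - τ}`, the subtraction being modulo `Nt`
(that of `Fin Nt`). -/
def circShift {Nt : ℕ} [NeZero Nt] (τ : ℕ) (s : Fin Nt → ℂ) : Fin Nt → ℂ :=
  fun k => s (k - Fin.ofNat Nt τ)

/-- The modulation `[M_f s]_k = e(f (k - 1) / Nt) [s]_k`, `k = 1, …, Nt`; here `k` is counted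
from `0`. -/
def modulate {Nt : ℕ} (f : ℕ) (s : Fin Nt → ℂ) : Fin Nt → ℂ :=
  fun k => phase ((f : ℝ) / (Nt : ℝ) * ((k : ℕ) : ℝ)) * s k

/-- The MIMO radar measurement matrix generated by the signals `s 0, …, s (NT - 1)`. The row
index is (receiver, sample), antennas and samples being counted from `0`, and the columns
are indexed by the grid. -/
def radarMatrix {NT NR Nt : ℕ} [NeZero Nt] (s : Fin NT → Fin Nt → ℂ) :
    Matrix (Fin NR × Fin Nt) (Grid NT NR Nt) ℂ :=
  Matrix.of fun r Θ =>
    let β : ℝ := ((Θ.1 : ℕ) : ℝ) + 1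
    phase (dR NT * β * stepAngle NT NR * ((r.1 : ℕ) : ℝ)) *
      ∑ i : Fin NT, phase (dT * β * stepAngle NT NR * ((i : ℕ) : ℝ)) *
        modulate ((Θ.2.2 : ℕ) + 1) (circShift ((Θ.2.1 : ℕ) + 1) (s i)) r.2

/-- The rescaled matrix `Ã = A / √(NT * NR * Nt)`. -/
def scaledRadarMatrix {NT NR Nt : ℕ} [NeZero Nt] (s : Fin NT → Fin Nt → ℂ) :
    Matrix (Fin NR × Fin Nt) (Grid NT NR Nt) ℂ :=
  (((1 / Real.sqrt ((NT : ℝ) * (NR : ℝ) * (Nt : ℝ)) : ℝ)) : ℂ) • radarMatrix s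

/-- The submatrix consisting of the columns with index in `S`. -/
def columns {m ι : Type*} (A : Matrix m ι ℂ) (S : Finset ι) : Matrix m S ℂ :=
  A.submatrix id Subtype.val

/-- The Gram matrix `Ã_S^* Ã_S`. -/
def gram {NT NR Nt : ℕ} [NeZero Nt] (s : Fin NT → Fin Nt → ℂ) (S : Finset (Grid NT NR Nt)) :
    Matrix S S ℂ :=
  (columns (scaledRadarMatrix s) S).conjTranspose * columns (scaledRadarMatrix s) S

/-- The spectral norm of a square complex matrix: its operator norm on Euclidean space. -/
def opNorm {n : Type*} [Fintype n] [DecidableEq n] (M : Matrix n n ℂ) : ℝ :=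
  ‖Matrix.toEuclideanCLM (n := n) (𝕜 := ℂ) M‖

/-- The deviation `‖Ã_S^* Ã_S - Id‖`. -/
def gramDeviation {NT NR Nt : ℕ} [NeZero Nt] (s : Fin NT → Fin Nt → ℂ)
    (S : Finset (Grid NT NR Nt)) : ℝ :=
  opNorm (gram s S - 1)

/-- Two angle parameters are equivalent if their difference is a multiple of `NR`. -/
def AngleEquiv {NT NR : ℕ} (β β' : Fin (NT * NR)) : Prop :=
  (NR : ℤ) ∣ ((β' : ℕ) : ℤ) - ((β : ℕ) : ℤ)

instance {NT NR : ℕ} (β β' : Fin (NT * NR)) : Decidable (AngleEquiv β β') :=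
  inferInstanceAs (Decidable ((NR : ℤ) ∣ ((β' : ℕ) : ℤ) - ((β : ℕ) : ℤ)))

/-- The part `S_[β]` of the support set `S` in the angle class of `β`. -/
def classPart {NT NR Nt : ℕ} (S : Finset (Grid NT NR Nt)) (β : Fin (NT * NR)) :
    Finset (Grid NT NR Nt) :=
  S.filter fun Θ => AngleEquiv β Θ.1

/-- `S` is `η`-balanced: `η` is the smallest number with `|S_[β]| ≤ η |S| / NR` for all angle
classes `[β]`. -/
def IsBalanced {NT NR Nt : ℕ} (S : Finset (Grid NT NR Nt)) (η : ℝ) : Prop :=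
  IsLeast {η' : ℝ | ∀ β : Fin (NT * NR),
    ((classPart S β).card : ℝ) ≤ η' * ((S.card : ℝ) / (NR : ℝ))} η

/-- The standard complex Gaussian distribution: the law of `x + i y` with independent
`x, y ∼ N(0, 1/2)`. -/
def stdComplexGaussian : Measure ℂ :=
  ((gaussianReal 0 (1 / 2 : ℝ≥0)).prod (gaussianReal 0 (1 / 2 : ℝ≥0))).map
    Complex.measurableEquivRealProd.symm

/-- A standard complex Gaussian random vector: the entries are independent standard complex
Gaussian random variables. -/
def IsStdComplexGaussianVector {Ω : Type*} [MeasurableSpace Ω] {n : ℕ}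
    (X : Ω → Fin n → ℂ) (P : Measure Ω) : Prop :=
  (∀ k, HasLaw (fun ω => X ω k) stdComplexGaussian P) ∧ iIndepFun (fun k ω => X ω k) P

end MimoRadar

end

/-!
An entry of the Gram matrix `Ãₛ* Ãₛ` is the entry for a single receiver times an average of phases
over the receivers. By orthogonality of the characters of `ℤ / NR`, this average vanishes between
different angle classes and equals `1` within a class (`gram_apply`). A Hermitian
matrix which is block diagonal has the norm of one of its blocks, as one sees by restricting a maximal
eigenvector to a class meeting its support (`exists_gramDeviation_le`). The bound for balanced sets
is then a union bound over the `NR` classes.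

Inside one class, with `K = |S|` and `ρ = K / Nt`, the Gram matrix is `Φ* Φ`, where
`Φ = ∑ₐ gₐ Yₐ` has independent standard complex Gaussian coefficients, `∑ₐ Yₐ* Yₐ = 1` and
`∑ₐ Yₐ Yₐ* = ρ`. The estimate of the even moments of `‖Φ* Φ - 1‖` rests on three ingredients.

* Decoupling. By Jensen, the deviation `Φ* Φ - 1` is dominated by the difference of the Gram matrices
  of two independent copies, and a rotation by `π / 4` of the pair, which preserves the Gaussian
  measure, turns this difference into `U* V + V* U` with `U`, `V` independent copies of `Φ`
  (`lintegral_sub_gram_eq`).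
* A noncommutative Khintchine inequality. For a Gaussian series `X = ∑ⱼ xⱼ Bⱼ` with Hermitian
  coefficients and `∑ⱼ v Bⱼ² ≤ σ`, where `v` is the variance of the `xⱼ`, Gaussian integration by
  parts expresses `E tr X^(2m+2)` through the traces of `Bⱼ X^i Bⱼ X^(2m-i)`; in an eigenbasis of `X`
  these are at most the trace of `Bⱼ² X^(2m)`. Hence `E tr X^(2m+2) ≤ (2m+1) σ E tr X^(2m)`
  (`integral_trace_gaussSum_pow_le`). Integration by parts is only needed for polynomials, where it is
  an identity between moments of a real Gaussian (`integral_evalReal_X_mul`). Rectangular series are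
  reduced to Hermitian ones by dilation.
* Two applications of this inequality. Given `U`, the chaos `U* V + V* U` is a Hermitian series in `V`
  whose variance is `ρ U* U + W* W`, where `W` stacks the blocks `U* Yₐ`. Both `U` and `W` are
  rectangular Gaussian series; the variance of `W` involves a partial transpose of the coefficient
  tensor, whose norm is at most `ρ` by Schur's test because time shifts leave at most one nonzero
  sample per pair of grid points (`isDispersed_radarCoeff`).

The result is `E ‖Φ* Φ - 1‖^(2m) ≤ K² (2m)! (2ρ)^m`. Summing Markov's inequality over all `m` into a
hyperbolic cosine gives the tail `(16/7) K² exp (-δ / (4√ρ))` (`IsDispersed.measureReal_le`). The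
claimed bound `7 K exp (-δ / (8√ρ))` is trivial unless its right side is below `1`, and then half of
the exponent absorbs one factor `K`.
-/

open MeasureTheory ProbabilityTheory
open scoped NNReal

noncomputable section

namespace MimoRadar

open scoped ComplexOrder

/-! ### Gaussian integration by parts for polynomials -/

section

lemma integrable_pow_gaussianReal (v : ℝ≥0) (k : ℕ) :
    Integrable (fun x : ℝ => x ^ k) (gaussianReal 0 v) := by
  have h := (memLp_id_gaussianReal (μ := 0) (v := v) (k : ℝ≥0)).integrable_norm_pow'
  refine (integrable_norm_iff (by fun_prop)).1 ?_
  simpa using h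

lemma hasDerivAt_gaussianPDFReal {v : ℝ≥0} (hv : v ≠ 0) (x : ℝ) :
    HasDerivAt (gaussianPDFReal 0 v) (-(x / v) * gaussianPDFReal 0 v x) x := by
  have hv' : (v : ℝ) ≠ 0 := by exact_mod_cast hv
  have h : HasDerivAt (fun x : ℝ => -(x - 0) ^ 2 / (2 * (v : ℝ))) (-(x / v)) x := by
    have := (((hasDerivAt_id x).sub_const 0).pow 2).neg.div_const (2 * (v : ℝ))
    refine this.congr_deriv ?_
    simp
    field_simp
  have h2 := (h.exp).const_mul ((Real.sqrt (2 * Real.pi * v))⁻¹)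
  rw [gaussianPDFReal_def]
  refine h2.congr_deriv ?_
  ring

/-- Gaussian integration by parts for monomials. -/
lemma integral_pow_succ_gaussianReal {v : ℝ≥0} (hv : v ≠ 0) (k : ℕ) :
    ∫ x, x ^ (k + 1) ∂gaussianReal 0 v = v * k * ∫ x, x ^ (k - 1) ∂gaussianReal 0 v := by
  have hv' : (v : ℝ) ≠ 0 := by exact_mod_cast hv
  have hint : ∀ m : ℕ, Integrable (fun x : ℝ => x ^ m * gaussianPDFReal 0 v x) := by
    intro m
    have h := integrable_pow_gaussianReal v m
    rw [gaussianReal_of_var_ne_zero _ hv, integrable_withDensity_iff_integrable_smul'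
      (measurable_gaussianPDF 0 v) (by simp [gaussianPDF_lt_top])] at h
    refine h.congr (.of_forall fun x => ?_)
    simp [toReal_gaussianPDF, mul_comm]
  have key := integral_mul_deriv_eq_deriv_mul_of_integrable
    (u := fun x : ℝ => x ^ k) (v := gaussianPDFReal 0 v) (u' := fun x => k * x ^ (k - 1))
    (v' := fun x => -(x / v) * gaussianPDFReal 0 v x)
    (fun x _ => hasDerivAt_pow k x) (fun x _ => hasDerivAt_gaussianPDFReal hv x)
    (by
      refine ((hint (k + 1)).const_mul (-(1 / (v : ℝ)))).congr (.of_forall fun x => ?_)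
      simp only [Pi.mul_apply]; ring)
    (by
      refine ((hint (k - 1)).const_mul (k : ℝ)).congr (.of_forall fun x => ?_)
      simp only [Pi.mul_apply]; ring)
    (hint k)
  rw [integral_gaussianReal_eq_integral_smul hv, integral_gaussianReal_eq_integral_smul hv]
  have e1 : ∫ x : ℝ, x ^ k * (-(x / v) * gaussianPDFReal 0 v x)
      = -(1 / (v : ℝ)) * ∫ x, gaussianPDFReal 0 v x • x ^ (k + 1) := by
    rw [← integral_const_mul]
    congr 1 with x
    simp only [smul_eq_mul]; ring
  have e2 : ∫ x : ℝ, k * x ^ (k - 1) * gaussianPDFReal 0 v x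
      = k * ∫ x, gaussianPDFReal 0 v x • x ^ (k - 1) := by
    rw [← integral_const_mul]
    congr 1 with x
    simp only [smul_eq_mul]; ring
  rw [e1, e2] at key
  field_simp at key
  linarith

variable {J : Type*} [Fintype J]

/-- The law of a vector of independent centred real Gaussian variables of variance `v`. -/
def gaussPi (J : Type*) [Fintype J] (v : ℝ≥0) : Measure (J → ℝ) :=
  Measure.pi fun _ => gaussianReal 0 v

instance (v : ℝ≥0) : IsProbabilityMeasure (gaussPi J v) := by unfold gaussPi; infer_instance
instance (v : ℝ≥0) : IsGaussian (gaussPi J v) := by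
  have h : iIndepFun (fun (j : J) (x : J → ℝ) => x j) (gaussPi J v) :=
    iIndepFun_pi (X := fun _ y => y) fun _ => aemeasurable_id
  have h2 : HasGaussianLaw (fun (x : J → ℝ) j => x j) (gaussPi J v) := by
    refine iIndepFun.hasGaussianLaw (fun j => ⟨?_⟩) h
    rw [gaussPi, (measurePreserving_eval _ j).map_eq]
    infer_instance
  have h3 := h2.isGaussian_map
  rwa [show (fun (x : J → ℝ) j => x j) = id from rfl, Measure.map_id] at h3

/-- The value of a complex polynomial at a real point. -/
def evalReal (x : J → ℝ) : MvPolynomial J ℂ →+* ℂ := MvPolynomial.eval fun j => (x j : ℂ)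

lemma evalReal_monomial (x : J → ℝ) (e : J →₀ ℕ) (a : ℂ) :
    evalReal x (MvPolynomial.monomial e a) = a * ∏ j, (x j : ℂ) ^ e j := by
  rw [evalReal, MvPolynomial.eval_monomial, Finsupp.prod_fintype _ _ (by simp)]

lemma integrable_ofReal_pow_gaussianReal (v : ℝ≥0) (k : ℕ) :
    Integrable (fun x : ℝ => (x : ℂ) ^ k) (gaussianReal 0 v) := by
  simpa using (integrable_pow_gaussianReal v k).ofReal (𝕜 := ℂ)

lemma integrable_evalReal (v : ℝ≥0) (p : MvPolynomial J ℂ) :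
    Integrable (fun x => evalReal x p) (gaussPi J v) := by
  induction p using MvPolynomial.induction_on' with
  | add p q hp hq =>
    simp only [map_add]
    exact hp.add hq
  | monomial e a =>
    simp only [evalReal_monomial]
    refine Integrable.const_mul ?_ _
    exact Integrable.fintype_prod (f := fun j (y : ℝ) => (y : ℂ) ^ e j)
      fun j => integrable_ofReal_pow_gaussianReal v _

lemma integral_evalReal_monomial (v : ℝ≥0) (e : J →₀ ℕ) (a : ℂ) :
    ∫ x, evalReal x (MvPolynomial.monomial e a) ∂gaussPi J v
      = a * ∏ j, ((∫ y, y ^ e j ∂gaussianReal 0 v : ℝ) : ℂ) := by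
  simp only [evalReal_monomial]
  rw [integral_const_mul, gaussPi,
    integral_fintype_prod_eq_prod (fun j (y : ℝ) => (y : ℂ) ^ e j)]
  congr 2 with j
  rw [← integral_complex_ofReal]
  simp

/-- Gaussian integration by parts for polynomials in independent Gaussian variables. -/
lemma integral_evalReal_X_mul [DecidableEq J] {v : ℝ≥0} (hv : v ≠ 0) (j : J)
    (p : MvPolynomial J ℂ) :
    ∫ x, evalReal x (MvPolynomial.X j * p) ∂gaussPi J v
      = v * ∫ x, evalReal x (MvPolynomial.pderiv j p) ∂gaussPi J v := by
  induction p using MvPolynomial.induction_on' with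
  | add p q hp hq =>
    rw [mul_add]
    simp only [map_add]
    rw [integral_add (integrable_evalReal v _) (integrable_evalReal v _), hp, hq,
      integral_add (integrable_evalReal v _) (integrable_evalReal v _), mul_add]
  | monomial e a =>
    rw [MvPolynomial.X, MvPolynomial.monomial_mul, add_comm, MvPolynomial.pderiv_monomial,
      integral_evalReal_monomial, integral_evalReal_monomial,
      ← Finset.mul_prod_erase _ _ (Finset.mem_univ j),
      ← Finset.mul_prod_erase _ _ (Finset.mem_univ j)]
    have h : ∀ i ∈ Finset.univ.erase j,
        ((∫ y, y ^ (e + Finsupp.single j 1 : J →₀ ℕ) i ∂gaussianReal 0 v : ℝ) : ℂ)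
          = ((∫ y, y ^ (e - Finsupp.single j 1 : J →₀ ℕ) i ∂gaussianReal 0 v : ℝ) : ℂ) := by
      intro i hi
      have : i ≠ j := Finset.ne_of_mem_erase hi
      simp [this.symm]
    rw [Finset.prod_congr rfl h]
    have h2 : (e + Finsupp.single j 1 : J →₀ ℕ) j = e j + 1 := by simp
    have h3 : (e - Finsupp.single j 1 : J →₀ ℕ) j = e j - 1 := by simp
    rw [h2, h3, integral_pow_succ_gaussianReal hv]
    push_cast
    ring

end

/-! ### Moment recursion for Gaussian matrix series -/

section

variable {J : Type*} [Fintype J] {p q d : Type*} [Fintype p] [Fintype q] [Fintype d]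
  [DecidableEq d]

/-- The Gaussian matrix series `∑ j, x j • B j` at the sample point `x`. -/
def gaussSum (B : J → Matrix p q ℂ) (x : J → ℝ) : Matrix p q ℂ := ∑ j, (x j : ℂ) • B j

/-- The series `∑ j, X j • B j` with polynomial entries, whose values are those of `gaussSum`. -/
def polySum (B : J → Matrix p q ℂ) : Matrix p q (MvPolynomial J ℂ) :=
  ∑ j, (MvPolynomial.X j : MvPolynomial J ℂ) • (B j).map MvPolynomial.C

omit [Fintype p] [Fintype q] in
lemma map_polySum (B : J → Matrix p q ℂ) (x : J → ℝ) :
    (polySum B).map (evalReal x) = gaussSum B x := by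
  ext a b
  simp [polySum, gaussSum, Matrix.sum_apply, evalReal]

omit [Fintype p] [Fintype q] in
lemma map_pderiv_polySum [DecidableEq J] (B : J → Matrix p q ℂ) (j : J) :
    (polySum B).map (MvPolynomial.pderiv j) = (B j).map MvPolynomial.C := by
  ext a b
  simp [polySum, Matrix.sum_apply, MvPolynomial.pderiv_X, Pi.single_apply]

omit [Fintype J] [DecidableEq d] in
lemma map_pderiv_mul (j : J) (M N : Matrix d d (MvPolynomial J ℂ)) :
    (M * N).map (MvPolynomial.pderiv j)
      = M.map (MvPolynomial.pderiv j) * N + M * N.map (MvPolynomial.pderiv j) := by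
  refine Matrix.ext fun a b => ?_
  simp only [Matrix.map_apply, Matrix.mul_apply, Matrix.add_apply, map_sum, Derivation.leibniz,
    smul_eq_mul, ← Finset.sum_add_distrib]
  exact Finset.sum_congr rfl fun c _ => by ring

omit [Fintype J] in
lemma map_pderiv_pow (j : J) (M : Matrix d d (MvPolynomial J ℂ)) (k : ℕ) :
    (M ^ (k + 1)).map (MvPolynomial.pderiv j)
      = ∑ i ∈ Finset.range (k + 1), M ^ i * M.map (MvPolynomial.pderiv j) * M ^ (k - i) := by
  induction k with
  | zero => simp
  | succ k ih =>
    rw [pow_succ M (k + 1), map_pderiv_mul, ih, Finset.sum_range_succ _ (k + 1), Finset.sum_mul,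
      Nat.sub_self, pow_zero, mul_one]
    refine congrArg (· + _) (Finset.sum_congr rfl fun i hi => ?_)
    have : k + 1 - i = (k - i) + 1 := by have := Finset.mem_range.1 hi; omega
    rw [this, pow_succ M (k - i), ← mul_assoc]

omit [Fintype J] [Fintype d] [DecidableEq d] in
lemma map_pderiv_map_C (j : J) (B : Matrix d d ℂ) :
    (B.map MvPolynomial.C).map (MvPolynomial.pderiv j : _ → MvPolynomial J ℂ) = 0 := by
  ext a b; simp

omit [Fintype J] [Fintype d] [DecidableEq d] in
lemma map_C_map_evalReal (B : Matrix d d ℂ) (x : J → ℝ) :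
    (B.map MvPolynomial.C).map (evalReal x) = B := by
  ext a b; simp [evalReal]

/-- Gaussian integration by parts for the trace of a power of a Gaussian matrix series. -/
lemma integral_trace_gaussSum_pow {v : ℝ≥0} (hv : v ≠ 0) (B : J → Matrix d d ℂ) (k : ℕ) :
    ∫ x, (gaussSum B x ^ (k + 2)).trace ∂gaussPi J v
      = ∑ j, ∑ i ∈ Finset.range (k + 1),
          v * ∫ x, (B j * gaussSum B x ^ i * B j * gaussSum B x ^ (k - i)).trace
            ∂gaussPi J v := by
  classical
  have hev : ∀ (x : J → ℝ) (M : Matrix d d (MvPolynomial J ℂ)),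
      (M.map (evalReal x)).trace = evalReal x M.trace := by
    intro x M; simp [Matrix.trace]
  have hpow : ∀ x, gaussSum B x ^ (k + 2) = (polySum B ^ (k + 2)).map (evalReal x) := by
    intro x; rw [Matrix.map_pow, map_polySum]
  have hterm : ∀ x j i, (B j * gaussSum B x ^ i * B j * gaussSum B x ^ (k - i)).trace
      = evalReal x ((B j).map MvPolynomial.C * polySum B ^ i * (B j).map MvPolynomial.C
          * polySum B ^ (k - i)).trace := by
    intro x j i
    rw [← hev]
    simp only [Matrix.map_mul, Matrix.map_pow, map_polySum, map_C_map_evalReal]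
  simp_rw [hpow, hterm, hev]
  have hexp : (polySum B ^ (k + 2)).trace
      = ∑ j, MvPolynomial.X j * ((B j).map MvPolynomial.C * polySum B ^ (k + 1)).trace := by
    rw [pow_succ', polySum, Finset.sum_mul, Matrix.trace_sum, ← polySum]
    simp
  rw [hexp]
  simp_rw [map_sum]
  rw [integral_finsetSum _ fun j _ => integrable_evalReal v _]
  refine Finset.sum_congr rfl fun j _ => ?_
  rw [integral_evalReal_X_mul hv, ← Finset.mul_sum]
  congr 1
  have : MvPolynomial.pderiv j ((B j).map MvPolynomial.C * polySum B ^ (k + 1)).trace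
      = ∑ i ∈ Finset.range (k + 1), ((B j).map MvPolynomial.C * polySum B ^ i
          * (B j).map MvPolynomial.C * polySum B ^ (k - i)).trace := by
    have h1 : MvPolynomial.pderiv j ((B j).map MvPolynomial.C * polySum B ^ (k + 1)).trace
      = (((B j).map MvPolynomial.C * polySum B ^ (k + 1)).map (MvPolynomial.pderiv j)).trace := by
      simp [Matrix.trace]
    rw [h1, map_pderiv_mul, map_pderiv_map_C, zero_mul, zero_add, map_pderiv_pow,
      map_pderiv_polySum, Finset.mul_sum, Matrix.trace_sum]
    simp only [mul_assoc]
  rw [this]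
  simp_rw [map_sum]
  rw [integral_finsetSum _ fun j _ => integrable_evalReal v _]

/-- Chebyshev's sum inequality for two powers whose exponents have the same parity. -/
lemma pow_mul_pow_add_le {x y : ℝ} {i j : ℕ} (h : Even (i + j)) :
    y ^ i * x ^ j + x ^ i * y ^ j ≤ x ^ (i + j) + y ^ (i + j) := by
  have key : 0 ≤ (x ^ i - y ^ i) * (x ^ j - y ^ j) := by
    rcases Nat.even_or_odd i with hi | hi
    · have hj : Even j := (Nat.even_add.1 h).1 hi
      rw [← hi.pow_abs x, ← hi.pow_abs y, ← hj.pow_abs x, ← hj.pow_abs y]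
      rcases le_total |x| |y| with hxy | hxy
      · exact mul_nonneg_of_nonpos_of_nonpos (sub_nonpos.2 (by gcongr)) (sub_nonpos.2 (by gcongr))
      · exact mul_nonneg (sub_nonneg.2 (by gcongr)) (sub_nonneg.2 (by gcongr))
    · have hj : Odd j := by
        rw [← Nat.not_even_iff_odd] at hi ⊢
        exact fun hj => hi ((Nat.even_add.1 h).2 hj)
      rcases le_total x y with hxy | hxy
      · exact mul_nonneg_of_nonpos_of_nonpos (sub_nonpos.2 (hi.strictMono_pow.monotone hxy))
          (sub_nonpos.2 (hj.strictMono_pow.monotone hxy))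
      · exact mul_nonneg (sub_nonneg.2 (hi.strictMono_pow.monotone hxy))
          (sub_nonneg.2 (hj.strictMono_pow.monotone hxy))
  rw [pow_add, pow_add]
  linarith

/-- In an eigenbasis of `X`, the trace of `B X^i B X^j` is a combination, with nonnegative symmetric
weights, of products `x^i y^j` of eigenvalues. -/
lemma re_trace_mul_pow_mul_pow_le {X B : Matrix d d ℂ} (hX : X.IsHermitian) (hB : B.IsHermitian)
    {i j : ℕ} (h : Even (i + j)) :
    (B * X ^ i * B * X ^ j).trace.re ≤ (B * B * X ^ (i + j)).trace.re := by
  set φ := Unitary.conjStarAlgAut ℂ (Matrix d d ℂ) hX.eigenvectorUnitary with hφ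
  set e := hX.eigenvalues
  set D : Matrix d d ℂ := Matrix.diagonal (fun k => (e k : ℂ)) with hD
  have hXD : X = φ D := hX.spectral_theorem
  set B' := φ.symm B with hB'
  have hBB : B = φ B' := by simp [hB']
  have hB'h : B'.IsHermitian := by
    rw [Matrix.IsHermitian, ← Matrix.star_eq_conjTranspose, hB', ← map_star,
      Matrix.star_eq_conjTranspose, hB]
  have htr : ∀ M, (φ M).trace = M.trace := by
    intro M
    rw [hφ, Unitary.conjStarAlgAut_apply, Matrix.trace_mul_comm, ← mul_assoc]
    simp
  have hpow : ∀ k, D ^ k = Matrix.diagonal fun l => (e l : ℂ) ^ k := by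
    intro k; rw [hD, Matrix.diagonal_pow]; rfl
  have hw : ∀ k l, B' k l * B' l k = ((‖B' k l‖ ^ 2 : ℝ) : ℂ) := by
    intro k l
    have : B' l k = star (B' k l) := (hB'h.apply l k).symm
    rw [this, Complex.star_def, Complex.mul_conj, Complex.normSq_eq_norm_sq]
  have e1 : (B * X ^ i * B * X ^ j).trace.re
      = ∑ k, ∑ l, ‖B' k l‖ ^ 2 * (e l ^ i * e k ^ j) := by
    rw [hBB, hXD, ← map_pow, ← map_pow, ← map_mul, ← map_mul, ← map_mul, htr, hpow, hpow,
      Matrix.trace, Complex.re_sum]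
    refine Finset.sum_congr rfl fun k _ => ?_
    rw [Matrix.diag_apply, Matrix.mul_diagonal, Matrix.mul_apply, Finset.sum_mul, Complex.re_sum]
    refine Finset.sum_congr rfl fun l _ => ?_
    rw [Matrix.mul_diagonal]
    have : B' k l * (e l : ℂ) ^ i * B' l k * (e k : ℂ) ^ j
        = ((‖B' k l‖ ^ 2 * (e l ^ i * e k ^ j) : ℝ) : ℂ) := by
      rw [mul_right_comm (B' k l), hw]; push_cast; ring
    rw [this, Complex.ofReal_re]
  have e2 : (B * B * X ^ (i + j)).trace.re = ∑ k, ∑ l, ‖B' k l‖ ^ 2 * e k ^ (i + j) := by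
    rw [hBB, hXD, ← map_pow, ← map_mul, ← map_mul, htr, hpow, Matrix.trace, Complex.re_sum]
    refine Finset.sum_congr rfl fun k _ => ?_
    rw [Matrix.diag_apply, Matrix.mul_diagonal, Matrix.mul_apply, Finset.sum_mul, Complex.re_sum]
    refine Finset.sum_congr rfl fun l _ => ?_
    have : B' k l * B' l k * (e k : ℂ) ^ (i + j)
        = ((‖B' k l‖ ^ 2 * e k ^ (i + j) : ℝ) : ℂ) := by
      rw [hw]; push_cast; ring
    rw [this, Complex.ofReal_re]
  have hsymm : ∀ k l, ‖B' k l‖ = ‖B' l k‖ := by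
    intro k l
    rw [← hB'h.apply k l, norm_star]
  have e1' : ∑ k, ∑ l, ‖B' k l‖ ^ 2 * (e l ^ i * e k ^ j)
      = ∑ k, ∑ l, ‖B' k l‖ ^ 2 * (e k ^ i * e l ^ j) := by
    rw [Finset.sum_comm]
    exact Finset.sum_congr rfl fun k _ => Finset.sum_congr rfl fun l _ => by rw [hsymm]
  have e2' : ∑ k, ∑ l, ‖B' k l‖ ^ 2 * e k ^ (i + j)
      = ∑ k, ∑ l, ‖B' k l‖ ^ 2 * e l ^ (i + j) := by
    rw [Finset.sum_comm]
    exact Finset.sum_congr rfl fun k _ => Finset.sum_congr rfl fun l _ => by rw [hsymm]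
  have hsum : ∑ k, ∑ l, ‖B' k l‖ ^ 2 * (e l ^ i * e k ^ j)
        + ∑ k, ∑ l, ‖B' k l‖ ^ 2 * (e k ^ i * e l ^ j)
      ≤ ∑ k, ∑ l, ‖B' k l‖ ^ 2 * e k ^ (i + j) + ∑ k, ∑ l, ‖B' k l‖ ^ 2 * e l ^ (i + j) := by
    simp only [← Finset.sum_add_distrib, ← mul_add]
    refine Finset.sum_le_sum fun k _ => Finset.sum_le_sum fun l _ => ?_
    exact mul_le_mul_of_nonneg_left (pow_mul_pow_add_le h) (by positivity)
  rw [e1, e2]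
  linarith

omit [Fintype d] [DecidableEq d] in
lemma isHermitian_gaussSum {B : J → Matrix d d ℂ} (hB : ∀ j, (B j).IsHermitian) (x : J → ℝ) :
    (gaussSum B x).IsHermitian := by
  rw [Matrix.IsHermitian, gaussSum, Matrix.conjTranspose_sum]
  refine Finset.sum_congr rfl fun j _ => ?_
  rw [Matrix.conjTranspose_smul, (hB j).eq]
  simp

lemma re_trace_mul_pow_le {X R : Matrix d d ℂ} {ρ : ℝ} (hX : X.IsHermitian)
    (hR : ((ρ : ℂ) • (1 : Matrix d d ℂ) - R).PosSemidef) (m : ℕ) :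
    (R * X ^ (2 * m)).trace.re ≤ ρ * (X ^ (2 * m)).trace.re := by
  have h := hR.mul_mul_conjTranspose_same (X ^ m)
  rw [(hX.pow m).eq] at h
  have h1 := h.trace_nonneg
  rw [Matrix.trace_mul_comm, ← mul_assoc, ← pow_add, ← two_mul, mul_sub, Matrix.trace_sub,
    Matrix.trace_mul_comm _ R] at h1
  have h2 := (Complex.le_def.1 h1).1
  simp at h2
  linarith

/-- The moment recursion behind the noncommutative Khintchine inequality. -/
lemma integral_trace_gaussSum_pow_le {v : ℝ≥0} (hv : v ≠ 0) {B : J → Matrix d d ℂ} {ρ : ℝ}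
    (hB : ∀ j, (B j).IsHermitian)
    (hR : ((ρ : ℂ) • (1 : Matrix d d ℂ) - ∑ j, ((v : ℝ) : ℂ) • (B j * B j)).PosSemidef) (m : ℕ) :
    ∫ x, (gaussSum B x ^ (2 * (m + 1))).trace.re ∂gaussPi J v
      ≤ (2 * m + 1) * ρ * ∫ x, (gaussSum B x ^ (2 * m)).trace.re ∂gaussPi J v := by
  have hint : ∀ (M : Matrix d d (MvPolynomial J ℂ)),
      Integrable (fun x => (M.map (evalReal x)).trace) (gaussPi J v) := by
    intro M
    refine (integrable_evalReal v M.trace).congr (.of_forall fun x => ?_)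
    simp [Matrix.trace]
  have hint1 : ∀ k (A : Matrix d d ℂ),
      Integrable (fun x => (A * gaussSum B x ^ k).trace) (gaussPi J v) := by
    intro k A
    refine (hint (A.map MvPolynomial.C * polySum B ^ k)).congr (.of_forall fun x => ?_)
    simp only [Matrix.map_mul, Matrix.map_pow, map_polySum, map_C_map_evalReal]
  have hint2 : ∀ i k (A A' : Matrix d d ℂ),
      Integrable (fun x => (A * gaussSum B x ^ i * A' * gaussSum B x ^ k).trace)
        (gaussPi J v) := by
    intro i k A A'
    refine (hint (A.map MvPolynomial.C * polySum B ^ i * A'.map MvPolynomial.C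
      * polySum B ^ k)).congr (.of_forall fun x => ?_)
    simp only [Matrix.map_mul, Matrix.map_pow, map_polySum, map_C_map_evalReal]
  have hint0 : ∀ k, Integrable (fun x => (gaussSum B x ^ k).trace) (gaussPi J v) := by
    intro k; simpa using hint1 k 1
  have hre : ∀ f : (J → ℝ) → ℂ, Integrable f (gaussPi J v) →
      ∫ x, (f x).re ∂gaussPi J v = (∫ x, f x ∂gaussPi J v).re := by
    intro f hf
    exact integral_re hf
  have hstep : ∫ x, (gaussSum B x ^ (2 * (m + 1))).trace.re ∂gaussPi J v
      = ∑ j, ∑ i ∈ Finset.range (2 * m + 1), v * ∫ x,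
        (B j * gaussSum B x ^ i * B j * gaussSum B x ^ (2 * m - i)).trace.re ∂gaussPi J v := by
    rw [hre _ (hint0 _), show 2 * (m + 1) = 2 * m + 2 by ring,
      integral_trace_gaussSum_pow hv, Complex.re_sum]
    refine Finset.sum_congr rfl fun j _ => ?_
    rw [Complex.re_sum]
    refine Finset.sum_congr rfl fun i _ => ?_
    rw [hre _ (hint2 _ _ _ _)]
    exact Complex.re_ofReal_mul _ _
  rw [hstep]
  calc _ ≤ ∑ j, ∑ i ∈ Finset.range (2 * m + 1), v * ∫ x,
        (B j * B j * gaussSum B x ^ (2 * m)).trace.re ∂gaussPi J v := by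
        refine Finset.sum_le_sum fun j _ => Finset.sum_le_sum fun i hi => ?_
        refine mul_le_mul_of_nonneg_left ?_ v.2
        refine integral_mono (hint2 _ _ _ _).re (hint1 _ _).re fun x => ?_
        have hi' : i + (2 * m - i) = 2 * m := by have := Finset.mem_range.1 hi; omega
        have := re_trace_mul_pow_mul_pow_le (isHermitian_gaussSum hB x) (hB j)
          (i := i) (j := 2 * m - i) (by rw [hi']; simp)
        rwa [hi'] at this
    _ = (2 * m + 1) * ∫ x, ((∑ j, ((v : ℝ) : ℂ) • (B j * B j))
          * gaussSum B x ^ (2 * m)).trace.re ∂gaussPi J v := by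
        simp only [Finset.sum_const, Finset.card_range, nsmul_eq_mul, Finset.sum_mul,
          Matrix.trace_sum, Complex.re_sum]
        rw [integral_finsetSum]
        · rw [Finset.mul_sum]
          refine Finset.sum_congr rfl fun j _ => ?_
          rw [← integral_const_mul]
          push_cast
          congr 2 with x
          rw [smul_mul_assoc, Matrix.trace_smul, smul_eq_mul]
          exact (Complex.re_ofReal_mul _ _).symm
        · exact fun j _ => (hint1 _ _).re
    _ ≤ (2 * m + 1) * ∫ x, ρ * (gaussSum B x ^ (2 * m)).trace.re ∂gaussPi J v := by
        refine mul_le_mul_of_nonneg_left ?_ (by positivity)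
        refine integral_mono (hint1 _ _).re ((hint0 _).re.const_mul _) fun x => ?_
        exact re_trace_mul_pow_le (isHermitian_gaussSum hB x) hR m
    _ = _ := by rw [integral_const_mul]; ring

end

/-! ### Noncommutative Khintchine inequalities -/

open scoped Matrix Matrix.Norms.L2Operator

section Khintchine

variable {J : Type*} [Fintype J] {p q d : Type*} [Fintype p] [Fintype q] [Fintype d]
  [DecidableEq p] [DecidableEq q] [DecidableEq d]

/-- The double factorial `(2m - 1)!! = 1 * 3 * ⋯ * (2m - 1)`, the `2m`-th moment of a standard
real Gaussian variable. -/
def oddProd (m : ℕ) : ℝ := ∏ i ∈ Finset.range m, (2 * (i : ℝ) + 1)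

lemma oddProd_succ (m : ℕ) : oddProd (m + 1) = (2 * m + 1) * oddProd m := by
  rw [oddProd, Finset.prod_range_succ, mul_comm]; rfl

lemma oddProd_pos (m : ℕ) : 0 < oddProd m := Finset.prod_pos fun i _ => by positivity

lemma oddProd_sq_le (m : ℕ) : oddProd m ^ 2 ≤ ((2 * m).factorial : ℝ) := by
  induction m with
  | zero => simp [oddProd]
  | succ m ih =>
    rw [oddProd_succ, show 2 * (m + 1) = 2 * m + 1 + 1 by ring, Nat.factorial_succ,
      Nat.factorial_succ]
    push_cast
    rw [mul_pow]
    have h1 : (2 * (m : ℝ) + 1) ^ 2 ≤ (2 * m + 1 + 1) * (2 * m + 1) := by nlinarith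
    calc _ ≤ ((2 * (m : ℝ) + 1 + 1) * (2 * m + 1)) * ((2 * m).factorial : ℝ) := by gcongr
      _ = _ := by ring

/-- Noncommutative Khintchine inequality for a Hermitian Gaussian matrix series. -/
lemma integral_trace_pow_le_card {v : ℝ≥0} (hv : v ≠ 0) {B : J → Matrix d d ℂ} {ρ : ℝ}
    (hρ : 0 ≤ ρ) (hB : ∀ j, (B j).IsHermitian)
    (hR : ((ρ : ℂ) • (1 : Matrix d d ℂ) - ∑ j, ((v : ℝ) : ℂ) • (B j * B j)).PosSemidef) (m : ℕ) :
    ∫ x, (gaussSum B x ^ (2 * m)).trace.re ∂gaussPi J v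
      ≤ oddProd m * ρ ^ m * Fintype.card d := by
  induction m with
  | zero => simp [oddProd]
  | succ m ih =>
    refine (integral_trace_gaussSum_pow_le hv hB hR m).trans ?_
    calc _ ≤ (2 * m + 1) * ρ * (oddProd m * ρ ^ m * Fintype.card d) := by gcongr
      _ = _ := by rw [oddProd_succ]; ring

/-- The Hermitian dilation of a rectangular matrix. -/
def dilation (A : Matrix p q ℂ) : Matrix (p ⊕ q) (p ⊕ q) ℂ := Matrix.fromBlocks 0 A Aᴴ 0

omit [Fintype p] [Fintype q] [DecidableEq p] [DecidableEq q] in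
lemma isHermitian_dilation (A : Matrix p q ℂ) : (dilation A).IsHermitian := by
  simp [dilation, Matrix.IsHermitian, Matrix.fromBlocks_conjTranspose]

lemma dilation_mul_self (A : Matrix p q ℂ) :
    dilation A * dilation A = Matrix.fromBlocks (A * Aᴴ) 0 0 (Aᴴ * A) := by
  simp [dilation, Matrix.fromBlocks_multiply]

omit [Fintype p] [Fintype q] [DecidableEq p] [DecidableEq q] in
lemma gaussSum_dilation (A : J → Matrix p q ℂ) (x : J → ℝ) :
    gaussSum (fun j => dilation (A j)) x = dilation (gaussSum A x) := by
  have h : (gaussSum A x)ᴴ = ∑ j, (x j : ℂ) • (A j)ᴴ := by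
    simp [gaussSum, Matrix.conjTranspose_sum, Matrix.conjTranspose_smul]
  rw [dilation, h]
  ext a b
  rcases a with a | a <;> rcases b with b | b <;>
    simp [gaussSum, dilation, Matrix.sum_apply]

lemma trace_mul_conjTranspose_pow (A : Matrix p q ℂ) (m : ℕ) :
    ((A * Aᴴ) ^ (m + 1)).trace = ((Aᴴ * A) ^ (m + 1)).trace := by
  have h : ∀ k : ℕ, (A * Aᴴ) ^ k * A = A * (Aᴴ * A) ^ k := by
    intro k
    induction k with
    | zero => simp
    | succ k ih => rw [pow_succ, pow_succ', Matrix.mul_assoc, Matrix.mul_assoc A Aᴴ A,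
        ← Matrix.mul_assoc, ih, Matrix.mul_assoc, ← pow_succ, pow_succ']
  rw [pow_succ, ← Matrix.mul_assoc, h, Matrix.mul_assoc, Matrix.trace_mul_comm, pow_succ,
    Matrix.mul_assoc]

lemma trace_dilation_pow (A : Matrix p q ℂ) (m : ℕ) :
    (dilation A ^ (2 * (m + 1))).trace = 2 * ((Aᴴ * A) ^ (m + 1)).trace := by
  have h : ∀ k : ℕ, dilation A ^ (2 * k)
      = Matrix.fromBlocks ((A * Aᴴ) ^ k) 0 0 ((Aᴴ * A) ^ k) := by
    intro k
    induction k with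
    | zero => simp
    | succ k ih =>
      rw [mul_add, pow_add, ih, pow_two, dilation_mul_self, Matrix.fromBlocks_multiply]
      simp [pow_succ]
  have h2 := trace_mul_conjTranspose_pow A m
  rw [h, two_mul]
  nth_rewrite 1 [← h2]
  simp [Matrix.trace, Fintype.sum_sum_type]

omit [DecidableEq p] [DecidableEq q] in
lemma posSemidef_fromBlocks_diagonal {A : Matrix p p ℂ} {D : Matrix q q ℂ}
    (hA : A.PosSemidef) (hD : D.PosSemidef) : (Matrix.fromBlocks A 0 0 D).PosSemidef := by
  refine Matrix.PosSemidef.of_dotProduct_mulVec_nonneg ?_ fun x => ?_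
  · rw [Matrix.IsHermitian, Matrix.fromBlocks_conjTranspose, hA.1, hD.1]
    simp
  · have h1 := hA.dotProduct_mulVec_nonneg (x ∘ Sum.inl)
    have h2 := hD.dotProduct_mulVec_nonneg (x ∘ Sum.inr)
    rw [Matrix.fromBlocks_mulVec]
    simp only [dotProduct, Fintype.sum_sum_type] at h1 h2 ⊢
    simpa using add_nonneg h1 h2

/-- Noncommutative Khintchine inequality for a rectangular Gaussian matrix series. The dilation
has size `card p + card q`, but its second moment is controlled by `card q` alone. -/
lemma integral_trace_conjTranspose_mul_self_pow_le {v : ℝ≥0} (hv : v ≠ 0)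
    {A : J → Matrix p q ℂ} {σ : ℝ} (hσ : 0 ≤ σ)
    (h1 : ((σ : ℂ) • (1 : Matrix p p ℂ) - ∑ j, ((v : ℝ) : ℂ) • (A j * (A j)ᴴ)).PosSemidef)
    (h2 : ((σ : ℂ) • (1 : Matrix q q ℂ) - ∑ j, ((v : ℝ) : ℂ) • ((A j)ᴴ * A j)).PosSemidef)
    (m : ℕ) :
    ∫ x, (((gaussSum A x)ᴴ * gaussSum A x) ^ (m + 1)).trace.re ∂gaussPi J v
      ≤ oddProd (m + 1) * σ ^ (m + 1) * Fintype.card q := by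
  set B := fun j => dilation (A j) with hBdef
  have hB : ∀ j, (B j).IsHermitian := fun j => isHermitian_dilation _
  have hR : ((σ : ℂ) • (1 : Matrix (p ⊕ q) (p ⊕ q) ℂ)
      - ∑ j, ((v : ℝ) : ℂ) • (B j * B j)).PosSemidef := by
    convert posSemidef_fromBlocks_diagonal h1 h2 using 1
    simp only [hBdef, dilation_mul_self]
    ext a b
    rcases a with a | a <;> rcases b with b | b <;>
      simp [Matrix.sum_apply, Matrix.one_apply]
  have htr : ∀ k x, (gaussSum B x ^ (2 * (k + 1))).trace.re
      = 2 * (((gaussSum A x)ᴴ * gaussSum A x) ^ (k + 1)).trace.re := by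
    intro k x
    rw [hBdef, gaussSum_dilation, trace_dilation_pow]
    simp
  have hdouble : ∫ x, (gaussSum B x ^ (2 * (m + 1))).trace.re ∂gaussPi J v
      ≤ oddProd (m + 1) * σ ^ (m + 1) * (2 * Fintype.card q) := by
    induction m with
    | zero =>
      have hint : Integrable (fun x => (gaussSum B x ^ 2).trace) (gaussPi J v) := by
        refine (integrable_evalReal v ((polySum B) ^ 2).trace).congr (.of_forall fun x => ?_)
        simp only
        rw [← map_polySum B x, ← Matrix.map_pow]
        simp [Matrix.trace]
      have e := integral_trace_gaussSum_pow hv B 0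
      have e2 : ∫ x, (gaussSum B x ^ (2 * (0 + 1))).trace.re ∂gaussPi J v
          = 2 * (∑ j, ((v : ℝ) : ℂ) • ((A j)ᴴ * A j)).trace.re := by
        have : ∫ x, (gaussSum B x ^ (2 * (0 + 1))).trace.re ∂gaussPi J v
          = (∫ x, (gaussSum B x ^ 2).trace ∂gaussPi J v).re := integral_re hint
        rw [this, e]
        simp only [zero_add, Finset.range_one, Finset.sum_singleton, pow_zero, mul_one,
          integral_const, probReal_univ, one_smul, Matrix.trace_sum, Matrix.trace_smul,
          Nat.sub_zero, Complex.re_sum, Finset.mul_sum]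
        refine Finset.sum_congr rfl fun j _ => ?_
        have h3 := trace_dilation_pow (A j) 0
        rw [zero_add, mul_one, pow_two, pow_one] at h3
        rw [h3, mul_left_comm]
        simp
      have h4 := (Complex.le_def.1 h2.trace_nonneg).1
      rw [Matrix.trace_sub, Matrix.trace_smul, Matrix.trace_one] at h4
      simp only [Complex.zero_re, Complex.sub_re, smul_eq_mul, Complex.re_ofReal_mul,
        Complex.natCast_re] at h4
      have h5 : oddProd (0 + 1) = 1 := by simp [oddProd]
      rw [e2, h5, zero_add, pow_one]
      linarith
    | succ m ih =>
      refine (integral_trace_gaussSum_pow_le hv hB hR (m + 1)).trans ?_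
      calc _ ≤ (2 * ((m + 1 : ℕ) : ℝ) + 1) * σ
            * (oddProd (m + 1) * σ ^ (m + 1) * (2 * Fintype.card q)) := by gcongr
        _ = _ := by rw [oddProd_succ (m + 1)]; ring
  simp_rw [htr] at hdouble
  rw [integral_const_mul] at hdouble
  linarith

end Khintchine

section Norm

variable {d : Type*} [Fintype d] [DecidableEq d]

lemma trace_pow_eq_sum_eigenvalues {M : Matrix d d ℂ} (hM : M.IsHermitian) (k : ℕ) :
    (M ^ k).trace.re = ∑ i, hM.eigenvalues i ^ k := by
  conv_lhs => rw [hM.spectral_theorem, ← map_pow, Unitary.conjStarAlgAut_apply,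
    Matrix.trace_mul_comm, ← mul_assoc]
  rw [Matrix.diagonal_pow]
  simp only [Matrix.trace, Complex.re_sum]
  simp
  refine Finset.sum_congr rfl fun i _ => ?_
  norm_cast

lemma exists_norm_eq_abs_eigenvalue [Nonempty d] {M : Matrix d d ℂ} (hM : M.IsHermitian) :
    ∃ i, ‖M‖ = |hM.eigenvalues i| := by
  have h : ‖M‖ = ‖fun i => (hM.eigenvalues i : ℂ)‖ := by
    conv_lhs => rw [hM.spectral_theorem, Unitary.conjStarAlgAut_apply, ← Unitary.coe_star]
    rw [CStarRing.norm_mul_coe_unitary, CStarRing.norm_coe_unitary_mul, Matrix.l2_opNorm_diagonal]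
    rfl
  obtain ⟨i, -, hi⟩ := Finset.exists_mem_eq_sup' (Finset.univ_nonempty (α := d))
    (fun i => ‖(hM.eigenvalues i : ℂ)‖₊)
  refine ⟨i, ?_⟩
  rw [h, Pi.norm_def, ← Finset.sup'_eq_sup Finset.univ_nonempty, hi]
  simp

lemma norm_pow_le_trace_pow {M : Matrix d d ℂ} (hM : M.IsHermitian) {k : ℕ} (hk : Even k)
    (hk0 : k ≠ 0) : ‖M‖ ^ k ≤ (M ^ k).trace.re := by
  rcases isEmpty_or_nonempty d with hd | hd
  · rw [Subsingleton.elim M 0]; simp [hk0]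
  obtain ⟨i, hi⟩ := exists_norm_eq_abs_eigenvalue hM
  rw [hi, hk.pow_abs, trace_pow_eq_sum_eigenvalues hM]
  exact Finset.single_le_sum (f := fun i => hM.eigenvalues i ^ k)
    (fun j _ => hk.pow_nonneg _) (Finset.mem_univ i)

lemma norm_pow_le_trace_pow_of_posSemidef {M : Matrix d d ℂ} (hM : M.PosSemidef) {k : ℕ}
    (hk0 : k ≠ 0) : ‖M‖ ^ k ≤ (M ^ k).trace.re := by
  rcases isEmpty_or_nonempty d with hd | hd
  · rw [Subsingleton.elim M 0]; simp [hk0]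
  obtain ⟨i, hi⟩ := exists_norm_eq_abs_eigenvalue hM.1
  rw [hi, abs_of_nonneg (hM.eigenvalues_nonneg i), trace_pow_eq_sum_eigenvalues hM.1]
  exact Finset.single_le_sum (f := fun i => hM.1.eigenvalues i ^ k)
    (fun j _ => pow_nonneg (hM.eigenvalues_nonneg j) _) (Finset.mem_univ i)

lemma posSemidef_norm_smul_one_sub {M : Matrix d d ℂ} (hM : M.IsHermitian) :
    (((‖M‖ : ℝ) : ℂ) • (1 : Matrix d d ℂ) - M).PosSemidef := by
  refine Matrix.PosSemidef.of_dotProduct_mulVec_nonneg ?_ fun x => ?_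
  · rw [Matrix.IsHermitian, Matrix.conjTranspose_sub, hM.eq, Matrix.conjTranspose_smul]
    simp
  · have hreal : (star x ⬝ᵥ M *ᵥ x).im = 0 := hM.im_star_dotProduct_mulVec_self x
    set y : EuclideanSpace ℂ d := WithLp.toLp 2 x with hy
    have hxx : star x ⬝ᵥ x = ((‖y‖ ^ 2 : ℝ) : ℂ) := by
      have := inner_self_eq_norm_sq_to_K (𝕜 := ℂ) y
      rw [EuclideanSpace.inner_eq_star_dotProduct, dotProduct_comm] at this
      rw [this]; simp
    have hb : (star x ⬝ᵥ M *ᵥ x).re ≤ ‖M‖ * ‖y‖ ^ 2 := by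
      have h1 : star x ⬝ᵥ M *ᵥ x = inner ℂ y (WithLp.toLp 2 (M *ᵥ x)) := by
        rw [EuclideanSpace.inner_eq_star_dotProduct, dotProduct_comm]
      rw [h1]
      refine (Complex.re_le_norm _).trans ((norm_inner_le_norm _ _).trans ?_)
      have h2 := Matrix.l2_opNorm_mulVec M y
      have h3 : ‖(WithLp.toLp 2 (M *ᵥ x) : EuclideanSpace ℂ d)‖ ≤ ‖M‖ * ‖y‖ := h2
      nlinarith [norm_nonneg y]
    rw [Matrix.sub_mulVec, dotProduct_sub, Matrix.smul_mulVec, Matrix.one_mulVec,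
      dotProduct_smul, hxx, Complex.le_def]
    constructor
    · simp only [Complex.sub_re, smul_eq_mul, Complex.zero_re, ← Complex.ofReal_mul,
        Complex.ofReal_re]
      linarith
    · simp only [Complex.sub_im, smul_eq_mul, Complex.zero_im, ← Complex.ofReal_mul,
        Complex.ofReal_im, hreal]
      simp

end Norm

/-! ### The decoupled Gaussian chaos -/

section Chaos

variable {ι : Type*} [Fintype ι] {p q n S : Type*} [Fintype p] [Fintype q] [Fintype n] [Fintype S]
  [DecidableEq p] [DecidableEq q] [DecidableEq n] [DecidableEq S] [DecidableEq ι]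

/-- Coefficients, over the real variables `x (a, 0)` and `x (a, 1)`, of the series
`∑ a, (x (a, 0) + z * x (a, 1)) • A a`. With `z = I` the scalars are complex Gaussians, with
`z = -I` their conjugates. -/
def realify (z : ℂ) (A : ι → Matrix p q ℂ) (j : ι × Fin 2) : Matrix p q ℂ :=
  (if j.2 = 0 then 1 else z) • A j.1

omit [Fintype p] [Fintype q] [DecidableEq p] [DecidableEq q] [DecidableEq ι] in
lemma gaussSum_realify (z : ℂ) (A : ι → Matrix p q ℂ) (x : ι × Fin 2 → ℝ) :
    gaussSum (realify z A) x = ∑ a, ((x (a, 0) : ℂ) + z * x (a, 1)) • A a := by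
  simp only [gaussSum, Fintype.sum_prod_type, Fin.sum_univ_two, realify, smul_smul]
  refine Finset.sum_congr rfl fun a _ => ?_
  rw [if_pos trivial, if_neg one_ne_zero, mul_one, ← add_smul, mul_comm z]

omit [Fintype p] [DecidableEq p] [DecidableEq q] [DecidableEq ι] in
lemma sum_realify_mul_conjTranspose {z : ℂ} (hz : z * star z = 1) (A : ι → Matrix p q ℂ) :
    ∑ j, (((1 / 2 : ℝ≥0) : ℝ) : ℂ) • (realify z A j * (realify z A j)ᴴ)
      = ∑ a, A a * (A a)ᴴ := by
  rw [Fintype.sum_prod_type]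
  refine Finset.sum_congr rfl fun a _ => ?_
  simp only [Fin.sum_univ_two, realify, Matrix.conjTranspose_smul, Matrix.smul_mul,
    Matrix.mul_smul, smul_smul]
  have hz' : star z * z = 1 := by rw [mul_comm, hz]
  rw [← add_smul]
  simp only [Complex.star_def] at hz'
  simp [hz']
  norm_num

omit [Fintype q] [DecidableEq p] [DecidableEq q] [DecidableEq ι] in
lemma sum_conjTranspose_mul_realify {z : ℂ} (hz : z * star z = 1) (A : ι → Matrix p q ℂ) :
    ∑ j, (((1 / 2 : ℝ≥0) : ℝ) : ℂ) • ((realify z A j)ᴴ * realify z A j)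
      = ∑ a, (A a)ᴴ * A a := by
  rw [Fintype.sum_prod_type]
  refine Finset.sum_congr rfl fun a _ => ?_
  simp only [Fin.sum_univ_two, realify, Matrix.conjTranspose_smul, Matrix.smul_mul,
    Matrix.mul_smul, smul_smul]
  rw [← add_smul]
  simp only [Complex.star_def] at hz
  simp [hz]
  norm_num

lemma half_ne_zero : (1 / 2 : ℝ≥0) ≠ 0 := by norm_num

/-- The random matrix `∑ a, g a • Y a`, with `g a = x (a, 0) + I * x (a, 1)`. -/
def synth (Y : ι → Matrix n S ℂ) : (ι × Fin 2 → ℝ) → Matrix n S ℂ :=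
  gaussSum (realify Complex.I Y)

/-- The matrices `(Y b)ᴴ * Y a`, for fixed `b`, stacked over all `a`. The second-order coefficient
`(Y b)ᴴ * Y a` of the Gram matrix is thus read with `a` as a row index, which is a partial transpose
of the coefficient tensor. -/
def stacked (Y : ι → Matrix n S ℂ) (b : ι) : Matrix (ι × S) S ℂ :=
  Matrix.of fun aΘ Θ' => ((Y b)ᴴ * Y aΘ.1) aΘ.2 Θ'

/-- The matrices `(synth Y u)ᴴ * Y a` stacked over all `a`: a Gaussian series in the conjugate
variables, whence the coefficient `-I`. -/
def stackedSynth (Y : ι → Matrix n S ℂ) : (ι × Fin 2 → ℝ) → Matrix (ι × S) S ℂ :=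
  gaussSum (realify (-Complex.I) (stacked Y))

omit [Fintype n] [Fintype S] [DecidableEq n] [DecidableEq S] [DecidableEq ι] in
lemma conjTranspose_synth (Y : ι → Matrix n S ℂ) (u : ι × Fin 2 → ℝ) :
    (synth Y u)ᴴ = ∑ b, ((u (b, 0) : ℂ) + -Complex.I * u (b, 1)) • (Y b)ᴴ := by
  rw [synth, gaussSum_realify, Matrix.conjTranspose_sum]
  refine Finset.sum_congr rfl fun b _ => ?_
  rw [Matrix.conjTranspose_smul]
  simp

omit [Fintype S] [DecidableEq n] [DecidableEq S] [DecidableEq ι] in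
lemma stackedSynth_apply (Y : ι → Matrix n S ℂ) (u : ι × Fin 2 → ℝ) (a : ι) (Θ Θ' : S) :
    stackedSynth Y u (a, Θ) Θ' = ((synth Y u)ᴴ * Y a) Θ Θ' := by
  rw [conjTranspose_synth, Matrix.sum_mul, stackedSynth, gaussSum_realify]
  simp [Matrix.sum_apply, stacked]

omit [DecidableEq n] [DecidableEq S] [DecidableEq ι] in
lemma stackedSynth_conjTranspose_mul_self (Y : ι → Matrix n S ℂ) (u : ι × Fin 2 → ℝ) :
    (stackedSynth Y u)ᴴ * stackedSynth Y u
      = ∑ a, (Y a)ᴴ * synth Y u * (synth Y u)ᴴ * Y a := by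
  ext Θ Θ'
  rw [Matrix.mul_apply, Fintype.sum_prod_type, Matrix.sum_apply]
  refine Finset.sum_congr rfl fun a _ => ?_
  have : (Y a)ᴴ * synth Y u * (synth Y u)ᴴ * Y a
      = ((synth Y u)ᴴ * Y a)ᴴ * ((synth Y u)ᴴ * Y a) := by
    rw [Matrix.conjTranspose_mul, Matrix.conjTranspose_conjTranspose, Matrix.mul_assoc]
  rw [this, Matrix.mul_apply]
  refine Finset.sum_congr rfl fun Θ'' _ => ?_
  rw [Matrix.conjTranspose_apply, stackedSynth_apply, stackedSynth_apply,
    Matrix.conjTranspose_apply]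

/-- The conditional variance of the decoupled chaos `Uᴴ V + Vᴴ U`, given `U = synth Y u`. -/
def condVar (Y : ι → Matrix n S ℂ) (u : ι × Fin 2 → ℝ) : Matrix S S ℂ :=
  ∑ a, ((synth Y u)ᴴ * (Y a * (Y a)ᴴ) * synth Y u
    + (Y a)ᴴ * synth Y u * (synth Y u)ᴴ * Y a)

omit [DecidableEq S] [DecidableEq ι] in
lemma condVar_eq {Y : ι → Matrix n S ℂ} {ρ : ℝ}
    (h2 : ∑ a, Y a * (Y a)ᴴ = (ρ : ℂ) • 1) (u : ι × Fin 2 → ℝ) :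
    condVar Y u = (ρ : ℂ) • ((synth Y u)ᴴ * synth Y u)
      + (stackedSynth Y u)ᴴ * stackedSynth Y u := by
  rw [condVar, Finset.sum_add_distrib, stackedSynth_conjTranspose_mul_self, ← Matrix.sum_mul,
    ← Matrix.mul_sum, h2]
  simp

omit [DecidableEq n] [DecidableEq S] [DecidableEq ι] in
lemma isHermitian_condVar (Y : ι → Matrix n S ℂ) (u : ι × Fin 2 → ℝ) :
    (condVar Y u).IsHermitian := by
  rw [Matrix.IsHermitian, condVar, Matrix.conjTranspose_sum]
  refine Finset.sum_congr rfl fun a _ => ?_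
  simp [Matrix.conjTranspose_mul, Matrix.mul_assoc]

/-- The coefficients of the decoupled chaos `Uᴴ V + Vᴴ U`, with `U = synth Y u` fixed, as a
Gaussian series in the variables of `V`. -/
def decoupledCoeff (Y : ι → Matrix n S ℂ) (u : ι × Fin 2 → ℝ) (j : ι × Fin 2) : Matrix S S ℂ :=
  (synth Y u)ᴴ * realify Complex.I Y j + (realify Complex.I Y j)ᴴ * synth Y u

omit [Fintype S] [DecidableEq n] [DecidableEq S] [DecidableEq ι] in
lemma isHermitian_decoupledCoeff (Y : ι → Matrix n S ℂ) (u : ι × Fin 2 → ℝ) (j : ι × Fin 2) :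
    (decoupledCoeff Y u j).IsHermitian := by
  simp [decoupledCoeff, Matrix.IsHermitian, Matrix.conjTranspose_mul, add_comm]

omit [Fintype S] [DecidableEq n] [DecidableEq S] [DecidableEq ι] in
lemma gaussSum_decoupledCoeff (Y : ι → Matrix n S ℂ) (u x : ι × Fin 2 → ℝ) :
    gaussSum (decoupledCoeff Y u) x
      = (synth Y u)ᴴ * synth Y x + (synth Y x)ᴴ * synth Y u := by
  rw [show synth Y x = gaussSum (realify Complex.I Y) x from rfl]
  simp only [gaussSum, decoupledCoeff, Matrix.conjTranspose_sum, Matrix.conjTranspose_smul,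
    Matrix.mul_sum, Matrix.sum_mul, Matrix.mul_smul, Matrix.smul_mul, smul_add,
    Finset.sum_add_distrib, Complex.star_def, Complex.conj_ofReal]

omit [DecidableEq n] [DecidableEq ι] in
lemma sum_decoupledCoeff_mul_self (Y : ι → Matrix n S ℂ) (u : ι × Fin 2 → ℝ) :
    ∑ j, (((1 / 2 : ℝ≥0) : ℝ) : ℂ) • (decoupledCoeff Y u j * decoupledCoeff Y u j)
      = condVar Y u := by
  rw [Fintype.sum_prod_type, condVar]
  refine Finset.sum_congr rfl fun a _ => ?_
  simp only [Fin.sum_univ_two, decoupledCoeff, realify, Matrix.conjTranspose_smul,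
    Matrix.mul_smul, Matrix.smul_mul]
  generalize synth Y u = U
  have e1 : Uᴴ * (Y a * (Y a)ᴴ) * U = (Uᴴ * Y a) * ((Y a)ᴴ * U) := by
    simp [Matrix.mul_assoc]
  have e2 : (Y a)ᴴ * U * Uᴴ * Y a = ((Y a)ᴴ * U) * (Uᴴ * Y a) := by
    simp [Matrix.mul_assoc]
  rw [e1, e2]
  generalize Uᴴ * Y a = P
  generalize (Y a)ᴴ * U = Q
  simp only [if_true, one_ne_zero, if_false, star_one, one_smul, Complex.star_def,
    Complex.conj_I, neg_smul, mul_add, add_mul, Matrix.smul_mul, Matrix.mul_smul, smul_smul,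
    neg_mul, mul_neg, Complex.I_mul_I]
  have e3 : (((1 / 2 : ℝ≥0) : ℝ) : ℂ) = 1 / 2 := by simp
  rw [e3]
  module

omit [DecidableEq n] [DecidableEq ι] in
/-- Moments of the decoupled chaos in the variables `x`, for fixed `u`. -/
lemma integral_trace_decoupled_pow_le (Y : ι → Matrix n S ℂ) (u : ι × Fin 2 → ℝ) (m : ℕ) :
    ∫ x, (gaussSum (decoupledCoeff Y u) x ^ (2 * m)).trace.re ∂gaussPi (ι × Fin 2) (1 / 2)
      ≤ oddProd m * ‖condVar Y u‖ ^ m * Fintype.card S := by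
  refine integral_trace_pow_le_card half_ne_zero (norm_nonneg _)
    (isHermitian_decoupledCoeff Y u) ?_ m
  rw [sum_decoupledCoeff_mul_self]
  exact posSemidef_norm_smul_one_sub (isHermitian_condVar Y u)

omit [DecidableEq ι] in
lemma norm_condVar_pow_le {Y : ι → Matrix n S ℂ} {ρ : ℝ} (hρ : 0 ≤ ρ)
    (h2 : ∑ a, Y a * (Y a)ᴴ = (ρ : ℂ) • 1) (u : ι × Fin 2 → ℝ) (m : ℕ) :
    ‖condVar Y u‖ ^ (m + 1) ≤ 2 ^ m *
      (ρ ^ (m + 1) * (((synth Y u)ᴴ * synth Y u) ^ (m + 1)).trace.re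
        + (((stackedSynth Y u)ᴴ * stackedSynth Y u) ^ (m + 1)).trace.re) := by
  have hn : ‖condVar Y u‖ ≤ ρ * ‖(synth Y u)ᴴ * synth Y u‖
      + ‖(stackedSynth Y u)ᴴ * stackedSynth Y u‖ := by
    rw [condVar_eq h2]
    refine (norm_add_le _ _).trans ?_
    rw [norm_smul, Complex.norm_real, Real.norm_of_nonneg hρ]
  calc ‖condVar Y u‖ ^ (m + 1)
      ≤ (ρ * ‖(synth Y u)ᴴ * synth Y u‖
          + ‖(stackedSynth Y u)ᴴ * stackedSynth Y u‖) ^ (m + 1) := by gcongr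
    _ ≤ 2 ^ m * ((ρ * ‖(synth Y u)ᴴ * synth Y u‖) ^ (m + 1)
          + ‖(stackedSynth Y u)ᴴ * stackedSynth Y u‖ ^ (m + 1)) := by
        simpa using add_pow_le (mul_nonneg hρ (norm_nonneg _)) (norm_nonneg _) (m + 1)
    _ ≤ _ := by
        rw [mul_pow]
        gcongr
        · exact norm_pow_le_trace_pow_of_posSemidef
            (Matrix.posSemidef_conjTranspose_mul_self _) (by omega)
        · exact norm_pow_le_trace_pow_of_posSemidef
            (Matrix.posSemidef_conjTranspose_mul_self _) (by omega)

/-- Structural hypotheses on the coefficients of `synth Y` making `(synth Y)ᴴ * synth Y` a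
perturbation of the identity at scale `√ρ`: the Gram matrix has mean `1`, the rows are isotropic of
size `ρ`, and so is, up to an inequality, the partial transpose of the coefficient tensor. -/
structure IsDispersed (Y : ι → Matrix n S ℂ) (ρ : ℝ) : Prop where
  nonneg : 0 ≤ ρ
  le_one : ρ ≤ 1
  sum_conjTranspose_mul : ∑ a, (Y a)ᴴ * Y a = 1
  sum_mul_conjTranspose : ∑ a, Y a * (Y a)ᴴ = (ρ : ℂ) • 1
  stacked_le : ((ρ : ℂ) • (1 : Matrix (ι × S) (ι × S) ℂ)
    - ∑ b, stacked Y b * (stacked Y b)ᴴ).PosSemidef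

variable {Y : ι → Matrix n S ℂ} {ρ : ℝ}

omit [Fintype n] in
lemma posSemidef_smul_one {r : ℝ} (hr : 0 ≤ r) :
    ((r : ℂ) • (1 : Matrix n n ℂ)).PosSemidef :=
  Matrix.PosSemidef.one.smul (by exact_mod_cast hr)

lemma IsDispersed.sum_stacked (h : IsDispersed Y ρ) :
    ∑ b, (stacked Y b)ᴴ * stacked Y b = (ρ : ℂ) • 1 := by
  have h1 : ∑ b, (stacked Y b)ᴴ * stacked Y b
      = ∑ a, (Y a)ᴴ * (∑ b, Y b * (Y b)ᴴ) * Y a := by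
    simp only [Matrix.mul_sum, Matrix.sum_mul]
    rw [Finset.sum_comm]
    ext Θ Θ'
    simp only [Matrix.sum_apply]
    refine Finset.sum_congr rfl fun b _ => ?_
    rw [Matrix.mul_apply, Fintype.sum_prod_type]
    refine Finset.sum_congr rfl fun a _ => ?_
    have : (Y a)ᴴ * (Y b * (Y b)ᴴ) * Y a = ((Y b)ᴴ * Y a)ᴴ * ((Y b)ᴴ * Y a) := by
      rw [Matrix.conjTranspose_mul, Matrix.conjTranspose_conjTranspose]
      simp only [Matrix.mul_assoc]
    rw [this, Matrix.mul_apply]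
    rfl
  rw [h1, h.sum_mul_conjTranspose]
  simp [← Finset.smul_sum, h.sum_conjTranspose_mul]

lemma IsDispersed.integral_trace_synth_le (h : IsDispersed Y ρ) (m : ℕ) :
    ∫ x, (((synth Y x)ᴴ * synth Y x) ^ (m + 1)).trace.re ∂gaussPi (ι × Fin 2) (1 / 2)
      ≤ oddProd (m + 1) * Fintype.card S := by
  have h1 := integral_trace_conjTranspose_mul_self_pow_le half_ne_zero (σ := 1) zero_le_one
    (A := realify Complex.I Y) ?_ ?_ m
  · simpa [synth] using h1
  · rw [sum_realify_mul_conjTranspose (by simp), h.sum_mul_conjTranspose, ← sub_smul]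
    have := posSemidef_smul_one (n := n) (sub_nonneg.2 h.le_one)
    exact_mod_cast this
  · rw [sum_conjTranspose_mul_realify (by simp), h.sum_conjTranspose_mul]
    simpa using Matrix.PosSemidef.zero

lemma IsDispersed.integral_trace_stackedSynth_le (h : IsDispersed Y ρ) (m : ℕ) :
    ∫ x, (((stackedSynth Y x)ᴴ * stackedSynth Y x) ^ (m + 1)).trace.re
        ∂gaussPi (ι × Fin 2) (1 / 2)
      ≤ oddProd (m + 1) * ρ ^ (m + 1) * Fintype.card S := by
  refine integral_trace_conjTranspose_mul_self_pow_le half_ne_zero h.nonneg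
    (A := realify (-Complex.I) (stacked Y)) ?_ ?_ m
  · rw [sum_realify_mul_conjTranspose (by simp)]
    exact h.stacked_le
  · rw [sum_conjTranspose_mul_realify (by simp), h.sum_stacked, sub_self]
    exact Matrix.PosSemidef.zero

end Chaos

/-! ### Decoupling and the tail bound for the Gram matrix -/

open scoped ENNReal

section Integrability

variable {J : Type*} [Fintype J] {p q d : Type*} [Fintype p] [Fintype q] [Fintype d]
  [DecidableEq p] [DecidableEq q] [DecidableEq d]

lemma integrable_trace_gaussSum_pow (v : ℝ≥0) (B : J → Matrix d d ℂ) (k : ℕ) :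
    Integrable (fun x => (gaussSum B x ^ k).trace.re) (gaussPi J v) := by
  refine ((integrable_evalReal v ((polySum B) ^ k).trace).congr (.of_forall fun x => ?_)).re
  simp only
  rw [← map_polySum B x, ← Matrix.map_pow]
  simp [Matrix.trace]

lemma integrable_trace_conjTranspose_mul_self_pow (v : ℝ≥0) (A : J → Matrix p q ℂ) (k : ℕ) :
    Integrable (fun x => (((gaussSum A x)ᴴ * gaussSum A x) ^ (k + 1)).trace.re)
      (gaussPi J v) := by
  refine ((integrable_trace_gaussSum_pow v (fun j => dilation (A j)) (2 * (k + 1))).const_mul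
    (1 / 2)).congr (.of_forall fun x => ?_)
  simp only
  rw [gaussSum_dilation, trace_dilation_pow]
  simp

omit [Fintype p] [Fintype q] [DecidableEq p] [DecidableEq q] in
lemma continuous_gaussSum (A : J → Matrix p q ℂ) : Continuous (gaussSum A) := by
  unfold gaussSum
  fun_prop

lemma integral_id_gaussPi {v : ℝ≥0} (hv : v ≠ 0) : (gaussPi J v)[id] = 0 := by
  classical
  funext j
  have h1 := (ContinuousLinearMap.proj (R := ℝ) (φ := fun _ : J => ℝ) j).integral_comp_comm
    (IsGaussian.integrable_id (μ := gaussPi J v))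
  have h2 := integral_evalReal_X_mul hv j (1 : MvPolynomial J ℂ)
  simp only [mul_one, evalReal, MvPolynomial.eval_X] at h2
  have h3 : ((∫ x, x j ∂gaussPi J v : ℝ) : ℂ) = 0 := by
    rw [← integral_complex_ofReal]; simpa using h2
  have h4 : ∫ x, x j ∂gaussPi J v = 0 := by exact_mod_cast h3
  exact h1.symm.trans h4

lemma integral_mul_gaussPi [DecidableEq J] {v : ℝ≥0} (hv : v ≠ 0) (i j : J) :
    ∫ x, (x i : ℂ) * (x j : ℂ) ∂gaussPi J v = if i = j then ((v : ℝ) : ℂ) else 0 := by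
  have h := integral_evalReal_X_mul hv i (MvPolynomial.X j : MvPolynomial J ℂ)
  simp only [map_mul, evalReal, MvPolynomial.eval_X, MvPolynomial.pderiv_X] at h
  rw [h]
  split_ifs with hij
  · subst hij; simp
  · rw [Pi.single_eq_of_ne' hij]; simp

lemma integrable_mul_gaussPi (v : ℝ≥0) (i j : J) :
    Integrable (fun x => (x i : ℂ) * (x j : ℂ)) (gaussPi J v) := by
  refine (integrable_evalReal v (MvPolynomial.X i * MvPolynomial.X j)).congr
    (.of_forall fun x => ?_)
  simp [evalReal]

omit [Fintype q] [DecidableEq p] [DecidableEq q] in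
lemma conjTranspose_gaussSum_mul_self (A : J → Matrix p q ℂ) (x : J → ℝ) :
    (gaussSum A x)ᴴ * gaussSum A x
      = ∑ i, ∑ j, ((x i : ℂ) * (x j : ℂ)) • ((A i)ᴴ * A j) := by
  simp only [gaussSum, Matrix.conjTranspose_sum, Matrix.conjTranspose_smul, Matrix.sum_mul,
    Matrix.mul_sum, Matrix.smul_mul, Matrix.mul_smul, Complex.star_def, Complex.conj_ofReal,
    Finset.smul_sum, smul_smul]
  rw [Finset.sum_comm]
  simp only [mul_comm]

omit [DecidableEq p] in
lemma integrable_conjTranspose_gaussSum_mul_self (v : ℝ≥0) (A : J → Matrix p q ℂ) :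
    Integrable (fun x => (gaussSum A x)ᴴ * gaussSum A x) (gaussPi J v) := by
  simp only [conjTranspose_gaussSum_mul_self]
  exact integrable_finsetSum _ fun i _ => integrable_finsetSum _ fun j _ =>
    (integrable_mul_gaussPi v i j).smul_const _

omit [DecidableEq p] in
lemma integral_conjTranspose_gaussSum_mul_self {v : ℝ≥0} (hv : v ≠ 0) (A : J → Matrix p q ℂ) :
    ∫ x, (gaussSum A x)ᴴ * gaussSum A x ∂gaussPi J v
      = ∑ j, ((v : ℝ) : ℂ) • ((A j)ᴴ * A j) := by
  classical
  simp only [conjTranspose_gaussSum_mul_self]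
  rw [integral_finsetSum _ fun i _ => integrable_finsetSum _ fun j _ =>
    (integrable_mul_gaussPi v i j).smul_const _]
  refine Finset.sum_congr rfl fun i _ => ?_
  rw [integral_finsetSum _ fun j _ => (integrable_mul_gaussPi v i j).smul_const _]
  simp only [integral_smul_const, integral_mul_gaussPi hv]
  simp [ite_smul]

end Integrability

section Chaos

variable {ι : Type*} [Fintype ι] {n S : Type*} [Fintype n] [Fintype S]
  [DecidableEq n] [DecidableEq S] [DecidableEq ι] {Y : ι → Matrix n S ℂ} {ρ : ℝ}

lemma enorm_pow_eq_ofReal {E : Type*} [SeminormedAddCommGroup E] (a : E) (k : ℕ) :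
    ‖a‖ₑ ^ k = ENNReal.ofReal (‖a‖ ^ k) := by
  rw [ENNReal.ofReal_pow (norm_nonneg _), ofReal_norm]

lemma IsDispersed.lintegral_decoupled_le (h : IsDispersed Y ρ) (m : ℕ) :
    ∫⁻ u, ∫⁻ x, ‖(synth Y u)ᴴ * synth Y x + (synth Y x)ᴴ * synth Y u‖ₑ ^ (2 * (m + 1))
        ∂gaussPi (ι × Fin 2) (1 / 2) ∂gaussPi (ι × Fin 2) (1 / 2)
      ≤ ENNReal.ofReal
          ((Fintype.card S : ℝ) ^ 2 * (2 * (m + 1)).factorial * (2 * ρ) ^ (m + 1)) := by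
  set γ := gaussPi (ι × Fin 2) (1 / 2)
  set K : ℝ := ((Fintype.card S : ℕ) : ℝ)
  have hinner : ∀ u, ∫⁻ x, ‖(synth Y u)ᴴ * synth Y x + (synth Y x)ᴴ * synth Y u‖ₑ
        ^ (2 * (m + 1)) ∂γ
      ≤ ENNReal.ofReal (oddProd (m + 1) * ‖condVar Y u‖ ^ (m + 1) * K) := by
    intro u
    calc _ ≤ ∫⁻ x, ENNReal.ofReal (gaussSum (decoupledCoeff Y u) x ^ (2 * (m + 1))).trace.re ∂γ := by
          refine lintegral_mono fun x => ?_
          simp only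
          rw [← gaussSum_decoupledCoeff, enorm_pow_eq_ofReal]
          exact ENNReal.ofReal_le_ofReal (norm_pow_le_trace_pow
            (isHermitian_gaussSum (isHermitian_decoupledCoeff Y u) x) (by simp) (by omega))
      _ = ENNReal.ofReal
            (∫ x, (gaussSum (decoupledCoeff Y u) x ^ (2 * (m + 1))).trace.re ∂γ) := by
          rw [ofReal_integral_eq_lintegral_ofReal (integrable_trace_gaussSum_pow _ _ _)]
          exact .of_forall fun x => le_trans (by positivity) (norm_pow_le_trace_pow
            (isHermitian_gaussSum (isHermitian_decoupledCoeff Y u) x) (k := 2 * (m + 1))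
            (by simp) (by omega))
      _ ≤ _ := ENNReal.ofReal_le_ofReal (integral_trace_decoupled_pow_le Y u (m + 1))
  set f : (ι × Fin 2 → ℝ) → ℝ := fun u => oddProd (m + 1) * (2 ^ m *
      (ρ ^ (m + 1) * (((synth Y u)ᴴ * synth Y u) ^ (m + 1)).trace.re
        + (((stackedSynth Y u)ᴴ * stackedSynth Y u) ^ (m + 1)).trace.re)) * K with hf
  have i1 : Integrable (fun u => (((synth Y u)ᴴ * synth Y u) ^ (m + 1)).trace.re) γ :=
    integrable_trace_conjTranspose_mul_self_pow _ _ _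
  have i2 : Integrable
      (fun u => (((stackedSynth Y u)ᴴ * stackedSynth Y u) ^ (m + 1)).trace.re) γ :=
    integrable_trace_conjTranspose_mul_self_pow _ _ _
  have hfint : Integrable f γ :=
    ((((i1.const_mul _).add i2).const_mul _).const_mul _).mul_const _
  have hle : ∀ u, oddProd (m + 1) * ‖condVar Y u‖ ^ (m + 1) * K ≤ f u := by
    intro u
    have := norm_condVar_pow_le h.nonneg h.sum_mul_conjTranspose u m
    have := (oddProd_pos (m + 1)).le
    simp only [hf]
    gcongr
  have hf0 : ∀ u, 0 ≤ f u := fun u => le_trans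
    (by have := (oddProd_pos (m + 1)).le; positivity) (hle u)
  have hint : ∫ u, f u ∂γ ≤ K ^ 2 * (2 * (m + 1)).factorial * (2 * ρ) ^ (m + 1) := by
    simp only [hf]
    rw [integral_mul_const, integral_const_mul, integral_const_mul,
      integral_add (i1.const_mul _) i2, integral_const_mul]
    have b1 := h.integral_trace_synth_le m
    have b2 := h.integral_trace_stackedSynth_le m
    have hρ := h.nonneg
    have ho := (oddProd_pos (m + 1)).le
    calc _ ≤ oddProd (m + 1) * (2 ^ m * (ρ ^ (m + 1) * (oddProd (m + 1) * K)
            + oddProd (m + 1) * ρ ^ (m + 1) * K)) * K := by gcongr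
      _ = K ^ 2 * oddProd (m + 1) ^ 2 * (2 * ρ) ^ (m + 1) := by ring
      _ ≤ _ := by gcongr; exact oddProd_sq_le _
  calc _ ≤ ∫⁻ u, ENNReal.ofReal (f u) ∂γ :=
        lintegral_mono fun u => (hinner u).trans (ENNReal.ofReal_le_ofReal (hle u))
    _ = ENNReal.ofReal (∫ u, f u ∂γ) :=
        (ofReal_integral_eq_lintegral_ofReal hfint (.of_forall hf0)).symm
    _ ≤ _ := ENNReal.ofReal_le_ofReal hint

omit [Fintype n] [Fintype S] [DecidableEq n] [DecidableEq S] [DecidableEq ι] in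
lemma continuous_synth (Y : ι → Matrix n S ℂ) : Continuous (synth Y) := continuous_gaussSum _

omit [DecidableEq n] [DecidableEq ι] in
/-- The rotation by `π / 4` turns the decoupled chaos into a difference of independent copies of
the Gram matrix, and preserves the Gaussian measure. -/
lemma lintegral_sub_gram_eq (Y : ι → Matrix n S ℂ) (k : ℕ) :
    ∫⁻ x, ∫⁻ y, ‖(synth Y y)ᴴ * synth Y y - (synth Y x)ᴴ * synth Y x‖ₑ ^ k
        ∂gaussPi (ι × Fin 2) (1 / 2) ∂gaussPi (ι × Fin 2) (1 / 2)
      = ∫⁻ u, ∫⁻ x, ‖(synth Y u)ᴴ * synth Y x + (synth Y x)ᴴ * synth Y u‖ₑ ^ k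
        ∂gaussPi (ι × Fin 2) (1 / 2) ∂gaussPi (ι × Fin 2) (1 / 2) := by
  set γ := gaussPi (ι × Fin 2) (1 / 2) with hγ
  have hc := continuous_synth Y
  set F : (ι × Fin 2 → ℝ) × (ι × Fin 2 → ℝ) → ℝ≥0∞ := fun z =>
    ‖(synth Y z.1)ᴴ * synth Y z.2 + (synth Y z.2)ᴴ * synth Y z.1‖ₑ ^ k with hF
  have hFm : Measurable F := by
    have : Continuous fun z : (ι × Fin 2 → ℝ) × (ι × Fin 2 → ℝ) =>
        (synth Y z.1)ᴴ * synth Y z.2 + (synth Y z.2)ᴴ * synth Y z.1 := by fun_prop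
    exact this.enorm.measurable.pow_const k
  set G : (ι × Fin 2 → ℝ) × (ι × Fin 2 → ℝ) → ℝ≥0∞ := fun z =>
    ‖(synth Y z.2)ᴴ * synth Y z.2 - (synth Y z.1)ᴴ * synth Y z.1‖ₑ ^ k with hG
  have hGm : Measurable G := by
    have : Continuous fun z : (ι × Fin 2 → ℝ) × (ι × Fin 2 → ℝ) =>
        (synth Y z.2)ᴴ * synth Y z.2 - (synth Y z.1)ᴴ * synth Y z.1 := by fun_prop
    exact this.enorm.measurable.pow_const k
  rw [← lintegral_prod F hFm.aemeasurable, ← lintegral_prod G hGm.aemeasurable]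
  have hrot := IsGaussian.map_rotation_eq_self (μ := γ)
    (integral_id_gaussPi half_ne_zero) (Real.pi / 4)
  conv_rhs => rw [← hrot]
  rw [lintegral_map hFm (by fun_prop)]
  refine lintegral_congr fun z => ?_
  obtain ⟨x, y⟩ := z
  have hlin : ∀ a b : ℝ, synth Y (a • x + b • y) = (a : ℂ) • synth Y x + (b : ℂ) • synth Y y := by
    intro a b
    simp only [synth, gaussSum, Finset.smul_sum, ← Finset.sum_add_distrib]
    refine Finset.sum_congr rfl fun j _ => ?_
    simp only [Pi.add_apply, Pi.smul_apply, smul_eq_mul]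
    push_cast
    rw [add_smul, mul_smul, mul_smul]
  simp only [hF, hG, ContinuousLinearMap.rotation_apply, Real.cos_pi_div_four,
    Real.sin_pi_div_four, hlin]
  congr 2
  have hs : (((Real.sqrt 2 / 2 : ℝ)) : ℂ) * ((Real.sqrt 2 / 2 : ℝ) : ℂ) = 1 / 2 := by
    rw [← Complex.ofReal_mul]
    have : Real.sqrt 2 / 2 * (Real.sqrt 2 / 2) = 1 / 2 := by
      have := Real.mul_self_sqrt (show (0 : ℝ) ≤ 2 by norm_num)
      nlinarith
    rw [this]; simp
  generalize synth Y x = X at *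
  generalize synth Y y = Z at *
  simp only [Matrix.conjTranspose_add, Matrix.conjTranspose_smul, Matrix.add_mul, Matrix.mul_add,
    Matrix.smul_mul, Matrix.mul_smul, smul_smul, Complex.ofReal_neg, Complex.star_def,
    Complex.conj_ofReal, smul_add, Matrix.mul_neg, Matrix.neg_mul, Matrix.conjTranspose_neg, neg_smul,
    smul_neg, hs]
  module

/-- Jensen's inequality for the average over an independent copy of the Gram matrix. -/
lemma IsDispersed.enorm_pow_le_lintegral (h : IsDispersed Y ρ) (x : ι × Fin 2 → ℝ) {k : ℕ}
    (hk : 1 ≤ k) :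
    ‖(synth Y x)ᴴ * synth Y x - 1‖ₑ ^ k
      ≤ ∫⁻ y, ‖(synth Y y)ᴴ * synth Y y - (synth Y x)ᴴ * synth Y x‖ₑ ^ k
        ∂gaussPi (ι × Fin 2) (1 / 2) := by
  set γ := gaussPi (ι × Fin 2) (1 / 2)
  have hi : Integrable (fun y => (synth Y y)ᴴ * synth Y y) γ :=
    integrable_conjTranspose_gaussSum_mul_self _ _
  have hm : ∫ y, (synth Y y)ᴴ * synth Y y ∂γ = 1 := by
    have := integral_conjTranspose_gaussSum_mul_self half_ne_zero (realify Complex.I Y)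
    rw [sum_conjTranspose_mul_realify (by simp), h.sum_conjTranspose_mul] at this
    exact this
  have hs : ∫ y, ((synth Y y)ᴴ * synth Y y - (synth Y x)ᴴ * synth Y x) ∂γ
      = 1 - (synth Y x)ᴴ * synth Y x := by
    rw [integral_sub hi (integrable_const _), hm]; simp
  rw [← enorm_neg, neg_sub, ← hs]
  have h1 : ‖∫ y, ((synth Y y)ᴴ * synth Y y - (synth Y x)ᴴ * synth Y x) ∂γ‖ₑ
      ≤ eLpNorm (fun y => (synth Y y)ᴴ * synth Y y - (synth Y x)ᴴ * synth Y x) k γ := by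
    refine (enorm_integral_le_lintegral_enorm _).trans ?_
    rw [← eLpNorm_one_eq_lintegral_enorm]
    exact eLpNorm_le_eLpNorm_of_exponent_le (by exact_mod_cast hk)
      (hi.sub (integrable_const _)).aestronglyMeasurable
  calc _ ≤ eLpNorm (fun y => (synth Y y)ᴴ * synth Y y - (synth Y x)ᴴ * synth Y x) k γ ^ k := by
        gcongr
    _ = _ := by
        have := eLpNorm_nnreal_pow_eq_lintegral (μ := γ) (p := (k : ℝ≥0))
          (f := fun y => (synth Y y)ᴴ * synth Y y - (synth Y x)ᴴ * synth Y x)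
          (by positivity)
        simpa using this

/-- Moments of the deviation of the Gram matrix. -/
lemma IsDispersed.lintegral_gram_sub_one_le (h : IsDispersed Y ρ) (m : ℕ) :
    ∫⁻ x, ‖(synth Y x)ᴴ * synth Y x - 1‖ₑ ^ (2 * (m + 1)) ∂gaussPi (ι × Fin 2) (1 / 2)
      ≤ ENNReal.ofReal
          ((Fintype.card S : ℝ) ^ 2 * (2 * (m + 1)).factorial * (2 * ρ) ^ (m + 1)) :=
  calc _ ≤ _ := lintegral_mono fun x => h.enorm_pow_le_lintegral x (by omega)
    _ = _ := lintegral_sub_gram_eq Y _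
    _ ≤ _ := h.lintegral_decoupled_le m

/-- Tail bound for the Gram matrix, obtained by summing Markov's inequality for all even moments
into a hyperbolic cosine. -/
lemma IsDispersed.measureReal_le (h : IsDispersed Y ρ) (hρ : 0 < ρ) [Nonempty S] {δ : ℝ}
    (hδ : 0 < δ) :
    (gaussPi (ι × Fin 2) (1 / 2)).real {x | δ ≤ ‖(synth Y x)ᴴ * synth Y x - 1‖}
      ≤ 16 / 7 * (Fintype.card S : ℝ) ^ 2 * Real.exp (-(δ / (4 * Real.sqrt ρ))) := by
  set γ := gaussPi (ι × Fin 2) (1 / 2)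
  set K : ℝ := ((Fintype.card S : ℕ) : ℝ)
  set t := γ.real {x | δ ≤ ‖(synth Y x)ᴴ * synth Y x - 1‖} with ht
  have ht0 : 0 ≤ t := measureReal_nonneg
  have ht1 : t ≤ 1 := measureReal_le_one
  have hK : 1 ≤ K := Nat.one_le_cast.2 Fintype.card_pos
  have hc : Continuous fun x => (synth Y x)ᴴ * synth Y x - 1 := by
    have := continuous_synth Y
    fun_prop
  have hmarkov : ∀ m : ℕ, δ ^ (2 * (m + 1)) * t
      ≤ K ^ 2 * (2 * (m + 1)).factorial * (2 * ρ) ^ (m + 1) := by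
    intro m
    have h1 := mul_meas_ge_le_lintegral (μ := γ) (hc.enorm.measurable.pow_const (2 * (m + 1)))
      (ENNReal.ofReal (δ ^ (2 * (m + 1))))
    have h2 := h1.trans (h.lintegral_gram_sub_one_le m)
    have hsub : {x | δ ≤ ‖(synth Y x)ᴴ * synth Y x - 1‖} ⊆ {x | ENNReal.ofReal (δ ^ (2 * (m + 1)))
        ≤ ‖(synth Y x)ᴴ * synth Y x - 1‖ₑ ^ (2 * (m + 1))} := by
      intro x hx
      simp only [Set.mem_ofPred_eq] at hx ⊢
      rw [enorm_pow_eq_ofReal]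
      exact ENNReal.ofReal_le_ofReal (by gcongr)
    have h3 := (mul_le_mul_right (measure_mono (μ := γ) hsub)
      (ENNReal.ofReal (δ ^ (2 * (m + 1))))).trans h2
    have h4 := ENNReal.toReal_mono ENNReal.ofReal_ne_top h3
    rw [ENNReal.toReal_mul, ENNReal.toReal_ofReal (by positivity),
      ENNReal.toReal_ofReal (by positivity)] at h4
    exact h4
  -- with this `θ` the terms of `cosh θ - 1`, times `t`, are dominated by a geometric series
  set θ := δ / (4 * Real.sqrt ρ) with hθ
  have hsq : Real.sqrt ρ ^ 2 = ρ := Real.sq_sqrt hρ.le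
  have hsp : 0 < Real.sqrt ρ := Real.sqrt_pos.2 hρ
  have hterm : ∀ m : ℕ, θ ^ (2 * (m + 1)) / (2 * (m + 1)).factorial * t
      ≤ K ^ 2 * (1 / 8) ^ (m + 1) := by
    intro m
    have e : θ ^ (2 * (m + 1)) = δ ^ (2 * (m + 1)) / (16 * ρ) ^ (m + 1) := by
      rw [hθ, div_pow, pow_mul (4 * Real.sqrt ρ), mul_pow 4 (Real.sqrt ρ), hsq]; norm_num
    have hfac : (0 : ℝ) < (2 * (m + 1)).factorial := by positivity
    rw [e, div_div, div_mul_eq_mul_div, div_le_iff₀ (by positivity)]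
    refine (hmarkov m).trans (le_of_eq ?_)
    have : (2 * ρ) ^ (m + 1) = (1 / 8) ^ (m + 1) * (16 * ρ) ^ (m + 1) := by
      rw [← mul_pow]; congr 1; ring
    rw [this]; ring
  have hcosh := (hasSum_nat_add_iff' 1).2 (Real.hasSum_cosh θ)
  have hgeo := (hasSum_nat_add_iff' 1).2
    (hasSum_geometric_of_lt_one (r := (1 / 8 : ℝ)) (by norm_num) (by norm_num))
  simp only [Finset.range_one, Finset.sum_singleton, mul_zero, pow_zero, Nat.factorial_zero,
    Nat.cast_one, div_one] at hcosh hgeo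
  have hsum := hasSum_le hterm (hcosh.mul_right t) (hgeo.mul_left (K ^ 2))
  have hexp : Real.exp θ / 2 ≤ Real.cosh θ := by
    rw [Real.cosh_eq]
    have := Real.exp_pos (-θ)
    linarith
  have hfin : Real.exp θ * t ≤ 16 / 7 * K ^ 2 := by
    have h1 : Real.exp θ / 2 * t ≤ Real.cosh θ * t := by gcongr
    nlinarith
  rw [Real.exp_neg, ← div_eq_mul_inv, le_div_iff₀ (Real.exp_pos _), mul_comm]
  exact hfin

end Chaos

/-! ### The coefficients of the radar matrix -/

section Phase

lemma phase_add (x y : ℝ) : phase (x + y) = phase x * phase y := by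
  rw [phase, phase, phase, ← Complex.exp_add]
  push_cast
  ring_nf

lemma star_phase (x : ℝ) : star (phase x) = phase (-x) := by
  rw [phase, phase, Complex.star_def, ← Complex.exp_conj]
  simp [Complex.conj_ofNat]

lemma norm_phase (x : ℝ) : ‖phase x‖ = 1 := by
  rw [phase, show 2 * (Real.pi : ℂ) * Complex.I * x = ((2 * Real.pi * x : ℝ) : ℂ) * Complex.I by
    push_cast; ring]
  exact Complex.norm_exp_ofReal_mul_I _

lemma star_phase_mul (x y : ℝ) : star (phase x) * phase y = phase (y - x) := by
  rw [star_phase, ← phase_add]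
  ring_nf

lemma phase_nat_mul (n : ℕ) (x : ℝ) : phase (n * x) = phase x ^ n := by
  rw [phase, phase, ← Complex.exp_nat_mul]
  push_cast
  ring_nf

lemma phase_eq_one_iff (x : ℝ) : phase x = 1 ↔ ∃ n : ℤ, x = n := by
  rw [phase, Complex.exp_eq_one_iff]
  refine exists_congr fun n => ?_
  have h : (2 * (Real.pi : ℂ) * Complex.I) ≠ 0 := Complex.two_pi_I_ne_zero
  rw [mul_comm, mul_left_inj' h]
  exact_mod_cast Iff.rfl

/-- Orthogonality of the characters of a cyclic group. -/
lemma sum_phase_div (N : ℕ) [NeZero N] (d : ℤ) :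
    ∑ k : Fin N, phase ((d : ℝ) / N * (k : ℕ)) = if (N : ℤ) ∣ d then (N : ℂ) else 0 := by
  have hN : (N : ℝ) ≠ 0 := by exact_mod_cast NeZero.ne N
  have hpow : ∀ k : ℕ, phase ((d : ℝ) / N * k) = phase ((d : ℝ) / N) ^ k := by
    intro k; rw [mul_comm, phase_nat_mul]
  have hone : phase ((d : ℝ) / N) = 1 ↔ (N : ℤ) ∣ d := by
    rw [phase_eq_one_iff]
    refine exists_congr fun n => ?_
    rw [div_eq_iff hN]
    constructor
    · intro h; rw [mul_comm]; exact_mod_cast h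
    · intro h; rw [h]; push_cast; ring
  simp_rw [hpow]
  rw [Fin.sum_univ_eq_sum_range (fun k => phase ((d : ℝ) / N) ^ k)]
  split_ifs with h
  · simp [hone.2 h]
  · have hne : phase ((d : ℝ) / N) ≠ 1 := fun h' => h (hone.1 h')
    rw [geom_sum_eq hne, ← hpow, div_mul_cancel₀ _ hN, (phase_eq_one_iff d).2 ⟨d, rfl⟩, sub_self,
      zero_div]

end Phase

section Schur

variable {B P Q : Type*} [Fintype B] [Fintype P] [Fintype Q] [DecidableEq P]

omit [Fintype B] [Fintype Q] [DecidableEq P] in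
lemma star_dotProduct_self_eq (w : P → ℂ) :
    star w ⬝ᵥ w = ((∑ t, ‖w t‖ ^ 2 : ℝ) : ℂ) := by
  simp only [dotProduct, Pi.star_apply, Complex.star_def]
  push_cast
  exact Finset.sum_congr rfl fun t _ => by rw [← Complex.conj_mul']

/-- Schur's test: a bound `r` on the absolute row and column sums of the block row
`[C b]_b` bounds its norm. -/
lemma posSemidef_sub_sum_mul_conjTranspose (C : B → Matrix P Q ℂ) {r : ℝ} (hr : 0 ≤ r)
    (hrow : ∀ p, ∑ b, ∑ q, ‖C b p q‖ ≤ r) (hcol : ∀ b q, ∑ p, ‖C b p q‖ ≤ r) :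
    (((r ^ 2 : ℝ) : ℂ) • (1 : Matrix P P ℂ) - ∑ b, C b * (C b)ᴴ).PosSemidef := by
  refine Matrix.PosSemidef.of_dotProduct_mulVec_nonneg ?_ fun z => ?_
  · rw [Matrix.IsHermitian, Matrix.conjTranspose_sub, Matrix.conjTranspose_smul,
      Matrix.conjTranspose_sum]
    simp
  · have h1 : ∀ b, star z ⬝ᵥ (C b * (C b)ᴴ) *ᵥ z
        = ((∑ q, ‖((C b)ᴴ *ᵥ z) q‖ ^ 2 : ℝ) : ℂ) := by
      intro b
      have : star ((C b)ᴴ *ᵥ z) = star z ᵥ* C b := by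
        rw [Matrix.star_mulVec, Matrix.conjTranspose_conjTranspose]
      rw [← star_dotProduct_self_eq, this, ← Matrix.dotProduct_mulVec, Matrix.mulVec_mulVec]
    have hcs : ∀ b q, ‖((C b)ᴴ *ᵥ z) q‖ ^ 2 ≤ r * ∑ p, ‖C b p q‖ * ‖z p‖ ^ 2 := by
      intro b q
      have e : ‖((C b)ᴴ *ᵥ z) q‖ ≤ ∑ p, Real.sqrt ‖C b p q‖ * (Real.sqrt ‖C b p q‖ * ‖z p‖) := by
        simp only [Matrix.mulVec, dotProduct, Matrix.conjTranspose_apply]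
        refine (norm_sum_le _ _).trans (Finset.sum_le_sum fun p _ => ?_)
        rw [norm_mul, norm_star, ← mul_assoc, Real.mul_self_sqrt (norm_nonneg _)]
      calc ‖((C b)ᴴ *ᵥ z) q‖ ^ 2
          ≤ (∑ p, Real.sqrt ‖C b p q‖ * (Real.sqrt ‖C b p q‖ * ‖z p‖)) ^ 2 := by gcongr
        _ ≤ (∑ p, Real.sqrt ‖C b p q‖ ^ 2) * ∑ p, (Real.sqrt ‖C b p q‖ * ‖z p‖) ^ 2 :=
            Finset.sum_mul_sq_le_sq_mul_sq _ _ _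
        _ = (∑ p, ‖C b p q‖) * ∑ p, ‖C b p q‖ * ‖z p‖ ^ 2 := by
            simp only [mul_pow, Real.sq_sqrt (norm_nonneg _)]
        _ ≤ _ := by
            gcongr
            exact hcol b q
    have htot : ∑ b, ∑ q, ‖((C b)ᴴ *ᵥ z) q‖ ^ 2 ≤ r ^ 2 * ∑ p, ‖z p‖ ^ 2 := by
      calc _ ≤ ∑ b, ∑ q, r * ∑ p, ‖C b p q‖ * ‖z p‖ ^ 2 :=
            Finset.sum_le_sum fun b _ => Finset.sum_le_sum fun q _ => hcs b q
        _ = r * ∑ p, (∑ b, ∑ q, ‖C b p q‖) * ‖z p‖ ^ 2 := by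
            simp only [← Finset.mul_sum, Finset.sum_mul]
            congr 1
            rw [Finset.sum_comm]
            simp_rw [Finset.sum_comm (s := (Finset.univ : Finset B)) (t := (Finset.univ : Finset P))]
            rw [Finset.sum_comm]
            refine Finset.sum_congr rfl fun p _ => Finset.sum_comm
        _ ≤ r * ∑ p, r * ‖z p‖ ^ 2 := by
            gcongr with p _
            exact hrow p
        _ = _ := by rw [← Finset.mul_sum]; ring
    rw [Matrix.sub_mulVec, dotProduct_sub, Matrix.smul_mulVec, Matrix.one_mulVec, dotProduct_smul,
      star_dotProduct_self_eq, Matrix.sum_mulVec, dotProduct_sum]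
    simp only [h1]
    rw [smul_eq_mul, ← Complex.ofReal_mul, ← Complex.ofReal_sum, ← Complex.ofReal_sub]
    exact_mod_cast sub_nonneg.2 htot

end Schur

section Radar

variable {NT NR Nt : ℕ} [NeZero NT] [NeZero NR] [NeZero Nt]

/-- The delay of a grid point as an element of the cyclic group `Fin Nt`. -/
def delay (Θ : Grid NT NR Nt) : Fin Nt := Fin.ofNat Nt ((Θ.2.1 : ℕ) + 1)

/-- The transmit phase of the grid point `Θ` at the antenna `i`. -/
def transmitPhase (Θ : Grid NT NR Nt) (i : Fin NT) : ℂ :=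
  phase (dT * (((Θ.1 : ℕ) : ℝ) + 1) * stepAngle NT NR * ((i : ℕ) : ℝ))

/-- The Doppler phase of the grid point `Θ` at the sample `k`. -/
def dopplerPhase (Θ : Grid NT NR Nt) (k : Fin Nt) : ℂ :=
  phase ((((Θ.2.2 : ℕ) + 1 : ℕ) : ℝ) / (Nt : ℝ) * ((k : ℕ) : ℝ))

/-- The coefficient of the sample `k` of the signal `i` in the response at a single receiver,
normalized by `1 / √(NT * Nt)`. -/
def radarCoeff (S : Finset (Grid NT NR Nt)) (a : Fin NT × Fin Nt) : Matrix (Fin Nt) S ℂ :=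
  Matrix.of fun κ Θ => ((1 / Real.sqrt ((NT : ℝ) * Nt) : ℝ) : ℂ) *
    (transmitPhase Θ.1 a.1 * (dopplerPhase Θ.1 κ * if κ - delay Θ.1 = a.2 then 1 else 0))

omit [NeZero NT] [NeZero NR] in
lemma delay_injective {Θ Θ' : Grid NT NR Nt} (h : delay Θ = delay Θ') : Θ.2.1 = Θ'.2.1 := by
  have h1 : (Fin.ofNat Nt (Θ.2.1 : ℕ)) + 1 = Fin.ofNat Nt (Θ'.2.1 : ℕ) + 1 := by
    have e : ∀ k : ℕ, Fin.ofNat Nt (k + 1) = Fin.ofNat Nt k + 1 := by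
      intro k; ext; simp [Fin.val_add]
    rw [← e, ← e]; exact h
  have h2 := add_right_cancel h1
  simpa using h2

omit [NeZero NT] [NeZero NR] [NeZero Nt] in
lemma transmitPhase_eq (Θ : Grid NT NR Nt) (i : Fin NT) :
    transmitPhase Θ i
      = phase ((((Θ.1 : ℕ) : ℝ) + 1) / ((NT : ℝ) * NR) * ((i : ℕ) : ℝ)) := by
  rw [transmitPhase, dT, stepAngle]
  congr 1
  ring

omit [NeZero Nt] in
/-- Within an angle class the transmit steering vectors are orthogonal. -/
lemma sum_star_transmitPhase_mul {Θ Θ' : Grid NT NR Nt} (h : AngleEquiv Θ.1 Θ'.1) :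
    ∑ i, star (transmitPhase Θ i) * transmitPhase Θ' i = if Θ.1 = Θ'.1 then (NT : ℂ) else 0 := by
  obtain ⟨m, hm⟩ := h
  have hNR : (NR : ℝ) ≠ 0 := by exact_mod_cast NeZero.ne NR
  have hNT : (NT : ℝ) ≠ 0 := by exact_mod_cast NeZero.ne NT
  have hmR : ((Θ'.1 : ℕ) : ℝ) - ((Θ.1 : ℕ) : ℝ) = NR * m := by exact_mod_cast hm
  have hterm : ∀ i : Fin NT, star (transmitPhase Θ i) * transmitPhase Θ' i
      = phase ((m : ℝ) / NT * (i : ℕ)) := by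
    intro i
    rw [transmitPhase_eq, transmitPhase_eq, star_phase_mul]
    congr 1
    rw [← sub_mul, ← sub_div, add_sub_add_right_eq_sub, hmR]
    field_simp
  simp_rw [hterm]
  rw [sum_phase_div]
  refine if_congr ?_ rfl rfl
  constructor
  · rintro ⟨c, rfl⟩
    have h1 := Θ.1.2
    have h2 := Θ'.1.2
    have h3 : ((Θ'.1 : ℕ) : ℤ) - ((Θ.1 : ℕ) : ℤ) = (NT * NR : ℕ) * c := by
      rw [hm]; push_cast; ring
    ext
    have hc : c = 0 := by
      by_contra hc
      have h4 : ((NT * NR : ℕ) : ℤ) ≤ |((Θ'.1 : ℕ) : ℤ) - ((Θ.1 : ℕ) : ℤ)| := by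
        rw [h3, abs_mul]
        have : 1 ≤ |c| := Int.one_le_abs hc
        rw [Nat.abs_cast]
        nlinarith [Int.natCast_nonneg (NT * NR)]
      rw [le_abs] at h4
      omega
    rw [hc, mul_zero] at h3
    omega
  · intro h
    rw [h, sub_self] at hm
    have : m = 0 := by
      rcases mul_eq_zero.1 hm.symm with h | h
      · exact absurd (by exact_mod_cast h) (NeZero.ne NR)
      · exact h
    simp [this]

omit [NeZero NT] [NeZero NR] in
lemma sum_star_dopplerPhase_mul (Θ Θ' : Grid NT NR Nt) :
    ∑ k, star (dopplerPhase Θ k) * dopplerPhase Θ' k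
      = if Θ.2.2 = Θ'.2.2 then (Nt : ℂ) else 0 := by
  have hterm : ∀ k : Fin Nt, star (dopplerPhase Θ k) * dopplerPhase Θ' k
      = phase (((((Θ'.2.2 : ℕ) : ℤ) - ((Θ.2.2 : ℕ) : ℤ) : ℤ) : ℝ) / Nt * (k : ℕ)) := by
    intro k
    rw [dopplerPhase, dopplerPhase, star_phase_mul]
    congr 1
    push_cast
    ring
  simp_rw [hterm]
  rw [sum_phase_div]
  refine if_congr ?_ rfl rfl
  have h1 := Θ.2.2.2
  have h2 := Θ'.2.2.2
  constructor
  · intro h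
    ext
    have := Int.eq_zero_of_abs_lt_dvd h (by rw [abs_lt]; omega)
    omega
  · intro h; rw [h]; simp

omit [NeZero NT] [NeZero NR] [NeZero Nt] in
lemma norm_transmitPhase (Θ : Grid NT NR Nt) (i : Fin NT) : ‖transmitPhase Θ i‖ = 1 :=
  norm_phase _

omit [NeZero NT] [NeZero NR] [NeZero Nt] in
lemma norm_dopplerPhase (Θ : Grid NT NR Nt) (k : Fin Nt) : ‖dopplerPhase Θ k‖ = 1 :=
  norm_phase _

lemma star_mul_self_of_norm {z : ℂ} (h : ‖z‖ = 1) : star z * z = 1 := by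
  rw [Complex.star_def, Complex.conj_mul', h]; simp

omit [NeZero NT] [NeZero Nt] in
lemma scale_mul_self :
    ((1 / Real.sqrt ((NT : ℝ) * Nt) : ℝ) : ℂ) * ((1 / Real.sqrt ((NT : ℝ) * Nt) : ℝ) : ℂ)
      = 1 / ((NT : ℂ) * Nt) := by
  rw [← Complex.ofReal_mul, ← pow_two, div_pow, one_pow, Real.sq_sqrt (by positivity)]
  push_cast
  rfl

omit [NeZero NT] [NeZero NR] in
lemma star_radarCoeff_mul (S : Finset (Grid NT NR Nt)) (a a' : Fin NT × Fin Nt) (κ κ' : Fin Nt)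
    (Θ Θ' : S) :
    star (radarCoeff S a κ Θ) * radarCoeff S a' κ' Θ'
      = 1 / ((NT : ℂ) * Nt) * (star (transmitPhase Θ.1 a.1) * transmitPhase Θ'.1 a'.1)
        * (star (dopplerPhase Θ.1 κ) * dopplerPhase Θ'.1 κ')
        * ((if κ - delay Θ.1 = a.2 then 1 else 0) * if κ' - delay Θ'.1 = a'.2 then 1 else 0) := by
  rw [← scale_mul_self]
  simp only [radarCoeff, Matrix.of_apply, star_mul', Complex.star_def, Complex.conj_ofReal]
  have : (starRingEnd ℂ) (if κ - delay Θ.1 = a.2 then 1 else 0)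
      = if κ - delay Θ.1 = a.2 then 1 else 0 := by split_ifs <;> simp
  rw [this]
  ring

lemma sum_conjTranspose_radarCoeff_mul (S : Finset (Grid NT NR Nt))
    (hS : ∀ Θ ∈ S, ∀ Θ' ∈ S, AngleEquiv Θ.1 Θ'.1) :
    ∑ a, (radarCoeff S a)ᴴ * radarCoeff S a = 1 := by
  ext Θ Θ'
  have hNT : (NT : ℂ) ≠ 0 := by exact_mod_cast NeZero.ne NT
  have hNt : (Nt : ℂ) ≠ 0 := by exact_mod_cast NeZero.ne Nt
  have key : (∑ a, (radarCoeff S a)ᴴ * radarCoeff S a) Θ Θ'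
      = 1 / ((NT : ℂ) * Nt) * (∑ i, star (transmitPhase Θ.1 i) * transmitPhase Θ'.1 i)
        * (∑ κ, star (dopplerPhase Θ.1 κ) * dopplerPhase Θ'.1 κ)
        * if delay Θ.1 = delay Θ'.1 then 1 else 0 := by
    rw [Matrix.sum_apply, Fintype.sum_prod_type,
      Finset.mul_sum _ (fun i => star (transmitPhase Θ.1 i) * transmitPhase Θ'.1 i),
      Finset.sum_mul, Finset.sum_mul]
    refine Finset.sum_congr rfl fun i _ => ?_
    simp only [Matrix.mul_apply, Matrix.conjTranspose_apply]
    rw [Finset.sum_comm, Finset.mul_sum, Finset.sum_mul]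
    refine Finset.sum_congr rfl fun κ _ => ?_
    simp only [star_radarCoeff_mul]
    rw [← Finset.mul_sum]
    congr 1
    simp [eq_comm]
  rw [key, sum_star_transmitPhase_mul (hS _ Θ.2 _ Θ'.2), sum_star_dopplerPhase_mul,
    Matrix.one_apply]
  by_cases h : Θ = Θ'
  · subst h
    simp only [if_true]
    field_simp
  · rw [if_neg h]
    by_cases h1 : Θ.1.1 = Θ'.1.1
    · by_cases h2 : Θ.1.2.2 = Θ'.1.2.2
      · have h3 : delay Θ.1 ≠ delay Θ'.1 := fun h3 => h (Subtype.ext (Prod.ext h1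
          (Prod.ext (delay_injective h3) h2)))
        simp [h3]
      · simp [h2]
    · simp [h1]

omit [NeZero NR] in
lemma sum_radarCoeff_mul_conjTranspose (S : Finset (Grid NT NR Nt)) :
    ∑ a, radarCoeff S a * (radarCoeff S a)ᴴ = (((S.card : ℝ) / Nt : ℝ) : ℂ) • 1 := by
  have hNT : (NT : ℂ) ≠ 0 := by exact_mod_cast NeZero.ne NT
  have hNt : (Nt : ℂ) ≠ 0 := by exact_mod_cast NeZero.ne Nt
  ext κ κ'
  rw [Matrix.sum_apply, Fintype.sum_prod_type]
  simp only [Matrix.mul_apply, Matrix.conjTranspose_apply]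
  have hterm : ∀ (i : Fin NT), ∑ k : Fin Nt, ∑ Θ : S,
        radarCoeff S (i, k) κ Θ * star (radarCoeff S (i, k) κ' Θ)
      = ∑ Θ : S, if κ = κ' then 1 / ((NT : ℂ) * Nt) else 0 := by
    intro i
    rw [Finset.sum_comm]
    refine Finset.sum_congr rfl fun Θ _ => ?_
    simp only [mul_comm (radarCoeff S _ κ Θ), star_radarCoeff_mul]
    rw [← Finset.mul_sum, star_mul_self_of_norm (norm_transmitPhase _ _)]
    have : (∑ k : Fin Nt, (if κ' - delay Θ.1 = k then 1 else 0)
        * (if κ - delay Θ.1 = k then (1 : ℂ) else 0)) = if κ = κ' then 1 else 0 := by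
      simp [eq_comm]
    rw [this]
    split_ifs with h
    · subst h
      rw [star_mul_self_of_norm (norm_dopplerPhase _ _)]
      ring
    · simp
  rw [Finset.sum_congr rfl fun i _ => hterm i]
  simp only [Finset.sum_const, Finset.card_univ, Fintype.card_coe, Fintype.card_fin,
    Matrix.smul_apply, Matrix.one_apply]
  split_ifs with h
  · simp
    field_simp
  · simp

omit [NeZero NT] [NeZero NR] in
/-- An entry of the coefficient tensor couples the samples `b.2` and `a.2` only if these differ by
the difference of the two delays. -/
lemma norm_stacked_radarCoeff_le (S : Finset (Grid NT NR Nt)) (b a : Fin NT × Fin Nt)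
    (Θ Θ' : S) :
    ‖stacked (radarCoeff S) b (a, Θ) Θ'‖
      ≤ 1 / ((NT : ℝ) * Nt) * if b.2 + delay Θ.1 - delay Θ'.1 = a.2 then 1 else 0 := by
  have h : stacked (radarCoeff S) b (a, Θ) Θ'
      = ∑ κ, star (radarCoeff S b κ Θ) * radarCoeff S a κ Θ' := by
    simp [stacked, Matrix.mul_apply]
  rw [h]
  refine (norm_sum_le _ _).trans ?_
  simp only [star_radarCoeff_mul, norm_mul, norm_star, norm_transmitPhase, norm_dopplerPhase]
  have h2 : ∀ κ : Fin Nt, ‖(if κ - delay Θ.1 = b.2 then (1 : ℂ) else 0)‖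
        * ‖(if κ - delay Θ'.1 = a.2 then (1 : ℂ) else 0)‖
      = if b.2 + delay Θ.1 = κ then
          (if b.2 + delay Θ.1 - delay Θ'.1 = a.2 then (1 : ℝ) else 0) else 0 := by
    intro κ
    by_cases h1 : b.2 + delay Θ.1 = κ
    · subst h1
      simp only [add_sub_cancel_right, if_true, norm_one, one_mul]
      split_ifs <;> simp
    · rw [if_neg h1, if_neg (fun h3 => h1 (by rw [← h3, sub_add_cancel]))]
      simp
  rw [← Finset.mul_sum]
  simp only [h2]
  simp

/-- Within an angle class, the coefficients of the radar matrix are dispersed at the scale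
`card S / Nt`. -/
lemma isDispersed_radarCoeff (S : Finset (Grid NT NR Nt))
    (hS : ∀ Θ ∈ S, ∀ Θ' ∈ S, AngleEquiv Θ.1 Θ'.1) (hcard : (S.card : ℝ) ≤ Nt) :
    IsDispersed (radarCoeff S) ((S.card : ℝ) / Nt) := by
  have hNT : (0 : ℝ) < NT := by exact_mod_cast NeZero.pos NT
  have hNt : (0 : ℝ) < Nt := by exact_mod_cast NeZero.pos Nt
  have h1 : (S.card : ℝ) / Nt ≤ 1 := (div_le_one hNt).2 hcard
  have h0 : 0 ≤ (S.card : ℝ) / Nt := by positivity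
  refine ⟨h0, h1, sum_conjTranspose_radarCoeff_mul S hS,
    sum_radarCoeff_mul_conjTranspose S, ?_⟩
  -- Schur's test gives the square of `card S / Nt`, which is at most `card S / Nt` itself
  have hschur := posSemidef_sub_sum_mul_conjTranspose (stacked (radarCoeff S)) h0 ?_ ?_
  · have h2 : (0 : ℝ) ≤ (S.card : ℝ) / Nt - ((S.card : ℝ) / Nt) ^ 2 := by nlinarith
    have h3 := (posSemidef_smul_one (n := (Fin NT × Fin Nt) × S) h2).add hschur
    convert h3 using 1
    push_cast
    rw [sub_smul]
    abel
  · rintro ⟨a, Θ⟩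
    calc _ ≤ ∑ b : Fin NT × Fin Nt, ∑ Θ' : S, 1 / ((NT : ℝ) * Nt)
            * if b.2 + delay Θ.1 - delay Θ'.1 = a.2 then 1 else 0 :=
          Finset.sum_le_sum fun b _ => Finset.sum_le_sum fun Θ' _ =>
            norm_stacked_radarCoeff_le S b a Θ Θ'
      _ = ∑ Θ' : S, ∑ _i : Fin NT, ∑ l : Fin Nt, 1 / ((NT : ℝ) * Nt)
            * if l = a.2 + delay Θ'.1 - delay Θ.1 then 1 else 0 := by
          rw [Finset.sum_comm]
          refine Finset.sum_congr rfl fun Θ' _ => ?_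
          rw [Fintype.sum_prod_type]
          refine Finset.sum_congr rfl fun i _ => Finset.sum_congr rfl fun l _ => ?_
          congr 1
          refine if_congr ?_ rfl rfl
          rw [eq_sub_iff_add_eq, sub_eq_iff_eq_add]
      _ ≤ _ := by
          simp
          field_simp
          exact le_rfl
  · intro b Θ'
    rw [Fintype.sum_prod_type]
    calc _ ≤ ∑ a : Fin NT × Fin Nt, ∑ Θ : S, 1 / ((NT : ℝ) * Nt)
            * if b.2 + delay Θ.1 - delay Θ'.1 = a.2 then 1 else 0 :=
          Finset.sum_le_sum fun a _ => Finset.sum_le_sum fun Θ _ =>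
            norm_stacked_radarCoeff_le S b a Θ Θ'
      _ = ∑ Θ : S, ∑ _i : Fin NT, ∑ k : Fin Nt, 1 / ((NT : ℝ) * Nt)
            * if b.2 + delay Θ.1 - delay Θ'.1 = k then 1 else 0 := by
          rw [Finset.sum_comm]
          refine Finset.sum_congr rfl fun Θ _ => ?_
          rw [Fintype.sum_prod_type]
      _ ≤ _ := by
          simp
          field_simp
          exact le_rfl

end Radar

/-! ### Block structure across angle classes -/

section Blocks

variable {NT NR Nt : ℕ} [NeZero NT] [NeZero NR] [NeZero Nt]

/-- The response at a single receiver, normalized by `1 / √(NT * Nt)`. -/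
def receiverMatrix (s : Fin NT → Fin Nt → ℂ) (S : Finset (Grid NT NR Nt)) :
    Matrix (Fin Nt) S ℂ :=
  ∑ a : Fin NT × Fin Nt, s a.1 a.2 • radarCoeff S a

omit [NeZero NT] [NeZero NR] in
lemma receiverMatrix_apply (s : Fin NT → Fin Nt → ℂ) (S : Finset (Grid NT NR Nt)) (κ : Fin Nt)
    (Θ : S) :
    receiverMatrix s S κ Θ = ((1 / Real.sqrt ((NT : ℝ) * Nt) : ℝ) : ℂ) *
      ∑ i, transmitPhase Θ.1 i * (dopplerPhase Θ.1 κ * s i (κ - delay Θ.1)) := by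
  rw [receiverMatrix, Matrix.sum_apply, Fintype.sum_prod_type, Finset.mul_sum]
  refine Finset.sum_congr rfl fun i _ => ?_
  simp [radarCoeff]
  ring

omit [NeZero NR] in
lemma scaledRadarMatrix_apply (s : Fin NT → Fin Nt → ℂ) (S : Finset (Grid NT NR Nt))
    (r : Fin NR × Fin Nt) (Θ : S) :
    scaledRadarMatrix s r Θ.1 = ((1 / Real.sqrt NR : ℝ) : ℂ)
      * phase ((((Θ.1.1 : ℕ) : ℝ) + 1) / NR * ((r.1 : ℕ) : ℝ)) * receiverMatrix s S r.2 Θ := by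
  have hNT : (NT : ℝ) ≠ 0 := by exact_mod_cast NeZero.ne NT
  have hscale : 1 / Real.sqrt ((NT : ℝ) * NR * Nt)
      = 1 / Real.sqrt NR * (1 / Real.sqrt ((NT : ℝ) * Nt)) := by
    rw [mul_right_comm, Real.sqrt_mul (by positivity)]
    field_simp
  have hph : dR NT * (((Θ.1.1 : ℕ) : ℝ) + 1) * stepAngle NT NR * ((r.1 : ℕ) : ℝ)
      = (((Θ.1.1 : ℕ) : ℝ) + 1) / NR * ((r.1 : ℕ) : ℝ) := by
    rw [dR, stepAngle]
    field_simp
  rw [receiverMatrix_apply, scaledRadarMatrix, Matrix.smul_apply, radarMatrix, Matrix.of_apply,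
    hscale, smul_eq_mul]
  simp only [hph, Complex.ofReal_mul]
  have hsum : ∑ i : Fin NT, phase (dT * (((Θ.1.1 : ℕ) : ℝ) + 1) * stepAngle NT NR * ((i : ℕ) : ℝ))
        * modulate ((Θ.1.2.2 : ℕ) + 1) (circShift ((Θ.1.2.1 : ℕ) + 1) (s i)) r.2
      = ∑ i, transmitPhase Θ.1 i * (dopplerPhase Θ.1 r.2 * s i (r.2 - delay Θ.1)) := rfl
  rw [hsum]
  ring

/-- Summing over the receivers kills the entries between different angle classes. -/
lemma gram_apply (s : Fin NT → Fin Nt → ℂ) (S : Finset (Grid NT NR Nt)) (Θ Θ' : S) :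
    gram s S Θ Θ' = if AngleEquiv Θ.1.1 Θ'.1.1 then
      ((receiverMatrix s S)ᴴ * receiverMatrix s S) Θ Θ' else 0 := by
  have hNR : (NR : ℂ) ≠ 0 := by exact_mod_cast NeZero.ne NR
  have hsq : ((1 / Real.sqrt NR : ℝ) : ℂ) * ((1 / Real.sqrt NR : ℝ) : ℂ) = 1 / NR := by
    rw [← Complex.ofReal_mul, ← pow_two, div_pow, one_pow, Real.sq_sqrt (by positivity)]
    push_cast; rfl
  have hterm : ∀ r : Fin NR × Fin Nt,
      star (scaledRadarMatrix s r Θ.1) * scaledRadarMatrix s r Θ'.1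
      = (1 / (NR : ℂ) * phase (((((Θ'.1.1 : ℕ) : ℤ) - ((Θ.1.1 : ℕ) : ℤ) : ℤ) : ℝ) / NR
          * ((r.1 : ℕ) : ℝ)))
        * (star (receiverMatrix s S r.2 Θ) * receiverMatrix s S r.2 Θ') := by
    intro r
    have hp : star (phase ((((Θ.1.1 : ℕ) : ℝ) + 1) / NR * ((r.1 : ℕ) : ℝ)))
        * phase ((((Θ'.1.1 : ℕ) : ℝ) + 1) / NR * ((r.1 : ℕ) : ℝ))
        = phase (((((Θ'.1.1 : ℕ) : ℤ) - ((Θ.1.1 : ℕ) : ℤ) : ℤ) : ℝ) / NR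
          * ((r.1 : ℕ) : ℝ)) := by
      rw [star_phase_mul]
      congr 1
      push_cast
      ring
    rw [scaledRadarMatrix_apply s S, scaledRadarMatrix_apply s S, ← hsq, ← hp]
    simp only [star_mul', Complex.star_def, Complex.conj_ofReal]
    ring
  have hsum : gram s S Θ Θ' = ∑ r : Fin NR × Fin Nt,
      star (scaledRadarMatrix s r Θ.1) * scaledRadarMatrix s r Θ'.1 := by
    simp [gram, Matrix.mul_apply, columns]
  rw [hsum, Finset.sum_congr rfl fun r _ => hterm r, Fintype.sum_prod_type]
  simp only
  rw [← Finset.sum_mul_sum, ← Finset.mul_sum, sum_phase_div]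
  have hiff : ((NR : ℤ) ∣ ((Θ'.1.1 : ℕ) : ℤ) - ((Θ.1.1 : ℕ) : ℤ))
      ↔ AngleEquiv Θ.1.1 Θ'.1.1 := Iff.rfl
  simp only [hiff]
  split_ifs with h
  · rw [one_div_mul_cancel hNR, one_mul, Matrix.mul_apply]
    rfl
  · simp

lemma gram_eq_of_equiv (s : Fin NT → Fin Nt → ℂ) {S : Finset (Grid NT NR Nt)}
    (hS : ∀ Θ ∈ S, ∀ Θ' ∈ S, AngleEquiv Θ.1 Θ'.1) :
    gram s S = (receiverMatrix s S)ᴴ * receiverMatrix s S := by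
  ext Θ Θ'
  rw [gram_apply, if_pos (hS _ Θ.2 _ Θ'.2)]

omit [NeZero NT] [NeZero NR] in
lemma AngleEquiv.symm {β β' : Fin (NT * NR)} (h : AngleEquiv β β') : AngleEquiv β' β := by
  have := (dvd_neg (α := ℤ)).2 h
  rwa [neg_sub] at this

omit [NeZero NT] [NeZero NR] in
lemma AngleEquiv.trans {β β' β'' : Fin (NT * NR)} (h : AngleEquiv β β') (h' : AngleEquiv β' β'') :
    AngleEquiv β β'' := by
  have := dvd_add h' h
  rwa [sub_add_sub_cancel] at this

omit [NeZero NT] [NeZero NR] [NeZero Nt] in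
lemma angleEquiv_of_mem_classPart {S : Finset (Grid NT NR Nt)} {β : Fin (NT * NR)} :
    ∀ Θ ∈ classPart S β, ∀ Θ' ∈ classPart S β, AngleEquiv Θ.1 Θ'.1 := by
  intro Θ h Θ' h'
  exact (Finset.mem_filter.1 h).2.symm.trans (Finset.mem_filter.1 h').2

omit [NeZero NT] [NeZero NR] in
lemma gramDeviation_eq_norm (s : Fin NT → Fin Nt → ℂ) (S : Finset (Grid NT NR Nt)) :
    gramDeviation s S = ‖gram s S - 1‖ := rfl

omit [NeZero NT] [NeZero NR] in
lemma isHermitian_gram_sub_one (s : Fin NT → Fin Nt → ℂ) (S : Finset (Grid NT NR Nt)) :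
    (gram s S - 1).IsHermitian := by
  rw [Matrix.IsHermitian, Matrix.conjTranspose_sub, gram]
  simp

lemma norm_eq_zero_of_isEmpty {d : Type*} [Fintype d] [DecidableEq d] [IsEmpty d]
    (M : Matrix d d ℂ) : ‖M‖ = 0 := by
  rw [Subsingleton.elim M 0, norm_zero]

/-- An eigenvalue of a matrix is bounded by its norm. -/
lemma abs_le_norm_of_mulVec_eq {d : Type*} [Fintype d] [DecidableEq d] {M : Matrix d d ℂ}
    {c : ℝ} {x : d → ℂ} (hx : x ≠ 0) (h : M *ᵥ x = (c : ℂ) • x) : |c| ≤ ‖M‖ := by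
  have h1 := Matrix.l2_opNorm_mulVec M (WithLp.toLp 2 x)
  have h2 : ‖(WithLp.toLp 2 (M *ᵥ x) : EuclideanSpace ℂ d)‖
      ≤ ‖M‖ * ‖(WithLp.toLp 2 x : EuclideanSpace ℂ d)‖ := h1
  rw [h, WithLp.toLp_smul, norm_smul, Complex.norm_real, Real.norm_eq_abs] at h2
  refine le_of_mul_le_mul_right h2 (norm_pos_iff.2 fun h0 => hx ?_)
  simpa using h0

lemma exists_eigenvector_norm {d : Type*} [Fintype d] [DecidableEq d] [Nonempty d]
    {M : Matrix d d ℂ} (hM : M.IsHermitian) :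
    ∃ (c : ℝ) (x : d → ℂ), x ≠ 0 ∧ M *ᵥ x = (c : ℂ) • x ∧ |c| = ‖M‖ := by
  obtain ⟨i, hi⟩ := exists_norm_eq_abs_eigenvalue hM
  refine ⟨hM.eigenvalues i, (hM.eigenvectorBasis i).ofLp, ?_, ?_, hi.symm⟩
  · intro h0
    have h1 := hM.eigenvectorBasis.orthonormal.1 i
    have h2 : hM.eigenvectorBasis i = 0 := by ext j; exact congrFun h0 j
    rw [h2, norm_zero] at h1
    exact zero_ne_one h1
  · rw [hM.mulVec_eigenvectorBasis i]
    ext j; simp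

omit [NeZero Nt] [NeZero NT] [NeZero NR] in
lemma classPart_subset (S : Finset (Grid NT NR Nt)) (β : Fin (NT * NR)) : classPart S β ⊆ S :=
  Finset.filter_subset _ _

/-- The rows of `gram s S - 1` with index in an angle class are supported on this class. -/
lemma gram_sub_one_mulVec (s : Fin NT → Fin Nt → ℂ) (S : Finset (Grid NT NR Nt))
    (β : Fin (NT * NR)) (x : S → ℂ) (Θ : classPart S β) :
    ((gram s S - 1) *ᵥ x) ⟨Θ.1, classPart_subset S β Θ.2⟩
      = ((gram s (classPart S β) - 1) *ᵥ
          fun Θ' => x ⟨Θ'.1, classPart_subset S β Θ'.2⟩) Θ := by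
  have hentry : ∀ Θ' : classPart S β, (gram s (classPart S β) - 1) Θ Θ'
      = (gram s S - 1) ⟨Θ.1, classPart_subset S β Θ.2⟩ ⟨Θ'.1, classPart_subset S β Θ'.2⟩ := by
    intro Θ'
    rw [Matrix.sub_apply, Matrix.sub_apply, Matrix.one_apply, Matrix.one_apply]
    exact congrArg₂ _ rfl (if_congr (by rw [Subtype.ext_iff, Subtype.ext_iff]) rfl rfl)
  have hzero : ∀ Θ' : S, Θ'.1 ∉ classPart S β →
      (gram s S - 1) ⟨Θ.1, classPart_subset S β Θ.2⟩ Θ' = 0 := by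
    intro Θ' h'
    have hΘ := (Finset.mem_filter.1 Θ.2).2
    have hne : ¬ AngleEquiv Θ.1.1 Θ'.1.1 := fun h =>
      h' (Finset.mem_filter.2 ⟨Θ'.2, hΘ.trans h⟩)
    have hne2 : (⟨Θ.1, classPart_subset S β Θ.2⟩ : S) ≠ Θ' := by
      rintro rfl
      exact h' Θ.2
    rw [Matrix.sub_apply, gram_apply, if_neg hne, Matrix.one_apply_ne hne2, sub_zero]
  simp only [Matrix.mulVec, dotProduct, hentry]
  symm
  refine Finset.sum_of_injOn (fun Θ' : classPart S β => ⟨Θ'.1, classPart_subset S β Θ'.2⟩)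
    (fun a _ b _ h => Subtype.ext (congrArg (fun t : S => t.1) h)) (by simp) ?_ (fun _ _ => rfl)
  intro Θ' _ h
  rw [hzero Θ' fun hm => h ⟨⟨Θ'.1, hm⟩, by simp, rfl⟩, zero_mul]

/-- The norm of the block-diagonal deviation is attained on an angle class: the restriction of a
maximal eigenvector to a class meeting its support is an eigenvector of that block. -/
lemma exists_gramDeviation_le (s : Fin NT → Fin Nt → ℂ) (S : Finset (Grid NT NR Nt)) :
    ∃ β, gramDeviation s S ≤ gramDeviation s (classPart S β) := by
  simp only [gramDeviation_eq_norm]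
  rcases isEmpty_or_nonempty S with hS | hS
  · refine ⟨⟨0, Nat.pos_of_ne_zero (NeZero.ne _)⟩, ?_⟩
    rw [norm_eq_zero_of_isEmpty]
    exact norm_nonneg _
  obtain ⟨c, x, hx, hMx, hc⟩ := exists_eigenvector_norm (isHermitian_gram_sub_one s S)
  obtain ⟨Θ, hΘ⟩ := Function.ne_iff.1 hx
  refine ⟨Θ.1.1, ?_⟩
  rw [← hc]
  have hmem : Θ.1 ∈ classPart S Θ.1.1 := Finset.mem_filter.2 ⟨Θ.2, by simp [AngleEquiv]⟩
  refine abs_le_norm_of_mulVec_eq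
    (x := fun Θ' : classPart S Θ.1.1 => x ⟨Θ'.1, classPart_subset S _ Θ'.2⟩)
    (Function.ne_iff.2 ⟨⟨Θ.1, hmem⟩, hΘ⟩) ?_
  ext Θ'
  rw [← gram_sub_one_mulVec, hMx]
  rfl

/-- A block of the deviation is a compression of it: extend a maximal eigenvector by zero. -/
lemma gramDeviation_classPart_le (s : Fin NT → Fin Nt → ℂ) (S : Finset (Grid NT NR Nt))
    (β : Fin (NT * NR)) : gramDeviation s (classPart S β) ≤ gramDeviation s S := by
  simp only [gramDeviation_eq_norm]
  rcases isEmpty_or_nonempty (classPart S β) with hS | hS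
  · rw [norm_eq_zero_of_isEmpty]
    exact norm_nonneg _
  obtain ⟨c, x, hx, hMx, hc⟩ :=
    exists_eigenvector_norm (isHermitian_gram_sub_one s (classPart S β))
  rw [← hc]
  obtain ⟨Θ₀, hΘ₀⟩ := Function.ne_iff.1 hx
  set y : S → ℂ := fun Θ => if h : Θ.1 ∈ classPart S β then x ⟨Θ.1, h⟩ else 0 with hy
  have hyx : (fun Θ' : classPart S β => y ⟨Θ'.1, classPart_subset S β Θ'.2⟩) = x := by
    funext Θ'
    simp [hy]
  refine abs_le_norm_of_mulVec_eq (x := y) (Function.ne_iff.2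
    ⟨⟨Θ₀.1, classPart_subset S β Θ₀.2⟩, by rw [← hyx] at hΘ₀; exact hΘ₀⟩) ?_
  ext Θ
  by_cases h : Θ.1 ∈ classPart S β
  · have h1 := gram_sub_one_mulVec s S β y ⟨Θ.1, h⟩
    rw [hyx, hMx] at h1
    rw [show Θ = ⟨Θ.1, classPart_subset S β h⟩ from rfl, h1]
    simp [hy, h]
  · have h2 : y Θ = 0 := by simp [hy, h]
    rw [Pi.smul_apply, h2, smul_zero, Matrix.mulVec, dotProduct]
    refine Finset.sum_eq_zero fun Θ' _ => ?_
    by_cases h' : Θ'.1 ∈ classPart S β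
    · have hne : ¬ AngleEquiv Θ.1.1 Θ'.1.1 := fun he => h (Finset.mem_filter.2
        ⟨Θ.2, (Finset.mem_filter.1 h').2.trans he.symm⟩)
      have hne2 : Θ ≠ Θ' := by rintro rfl; exact h h'
      rw [Matrix.sub_apply, gram_apply, if_neg hne, Matrix.one_apply_ne hne2, sub_zero, zero_mul]
    · have : y Θ' = 0 := by simp [hy, h']
      rw [this, mul_zero]

end Blocks

/-! ### The law of the signals and the tail bounds -/

section Law

instance : IsProbabilityMeasure stdComplexGaussian := by
  unfold stdComplexGaussian
  exact Measure.isProbabilityMeasure_map (by fun_prop)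

lemma map_gaussPi_finTwo :
    (gaussPi (Fin 2) (1 / 2)).map (fun z => (z 0 : ℂ) + Complex.I * z 1) = stdComplexGaussian := by
  have h := (measurePreserving_finTwoArrow (gaussianReal 0 (1 / 2 : ℝ≥0))).map_eq
  rw [stdComplexGaussian, ← h, Measure.map_map (by fun_prop) (by fun_prop)]
  rw [gaussPi]
  congr 1
  funext z
  apply Complex.ext <;> simp [Complex.measurableEquivRealProd, MeasurableEquiv.finTwoArrow]

lemma map_curry_pi {ι κ X : Type*} [Fintype ι] [Fintype κ] [MeasurableSpace X] (μ : Measure X)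
    [IsProbabilityMeasure μ] :
    (Measure.pi fun _ : ι × κ => μ).map (MeasurableEquiv.curry ι κ X)
      = Measure.pi fun _ : ι => Measure.pi fun _ : κ => μ := by
  have h := Measure.infinitePi_map_curry (fun (_ : ι) (_ : κ) => μ)
  simpa only [Measure.infinitePi_eq_pi] using h

/-- The complex signals with real and imaginary parts given by the coordinates of `x`. -/
def signals {N n : ℕ} (x : (Fin N × Fin n) × Fin 2 → ℝ) : Fin N → Fin n → ℂ :=
  fun i k => (x ((i, k), 0) : ℂ) + Complex.I * x ((i, k), 1)

lemma measurable_signals {N n : ℕ} : Measurable (signals (N := N) (n := n)) := by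
  unfold signals
  fun_prop

lemma map_signals {N n : ℕ} :
    (gaussPi ((Fin N × Fin n) × Fin 2) (1 / 2)).map signals
      = Measure.pi fun _ : Fin N => Measure.pi fun _ : Fin n => stdComplexGaussian := by
  have h1 := map_curry_pi (ι := Fin N × Fin n) (κ := Fin 2) (gaussianReal 0 (1 / 2 : ℝ≥0))
  have h2 : (Measure.pi fun _ : Fin N × Fin n => gaussPi (Fin 2) (1 / 2)).map
      (fun z a => (z a 0 : ℂ) + Complex.I * z a 1)
      = Measure.pi fun _ : Fin N × Fin n => stdComplexGaussian := by
    have hp : IsProbabilityMeasure ((gaussPi (Fin 2) (1 / 2)).map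
        fun z : Fin 2 → ℝ => (z 0 : ℂ) + Complex.I * z 1) :=
      Measure.isProbabilityMeasure_map (by fun_prop)
    have := Measure.pi_map_pi (μ := fun _ : Fin N × Fin n => gaussPi (Fin 2) (1 / 2))
      (f := fun _ (z : Fin 2 → ℝ) => (z 0 : ℂ) + Complex.I * z 1) (fun _ => by fun_prop)
    rw [this, map_gaussPi_finTwo]
  rw [← map_curry_pi (ι := Fin N) (κ := Fin n), ← h2]
  unfold gaussPi
  rw [← h1, Measure.map_map (by fun_prop) (by fun_prop), Measure.map_map (by fun_prop) (by fun_prop)]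
  rfl

/-- The signals have the law of `signals x` for a vector `x` of independent `N(0, 1/2)` variables. -/
lemma hasLaw_signals {N n : ℕ} {Ω : Type*} [MeasurableSpace Ω] {P : Measure Ω}
    {s : Fin N → Ω → Fin n → ℂ} (hs : ∀ i, IsStdComplexGaussianVector (s i) P)
    (hindep : iIndepFun s P) :
    HasLaw (fun ω i => s i ω) ((gaussPi ((Fin N × Fin n) × Fin 2) (1 / 2)).map signals) P := by
  rw [map_signals]
  exact hindep.hasLaw_pi fun i => (hs i).2.hasLaw_pi (hs i).1

end Law

section Tail

variable {NT NR Nt : ℕ} [NeZero NT] [NeZero NR] [NeZero Nt]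

omit [NeZero NT] [NeZero NR] in
lemma continuous_gramDeviation (S : Finset (Grid NT NR Nt)) :
    Continuous fun s : Fin NT → Fin Nt → ℂ => gramDeviation s S := by
  have h : Continuous fun s : Fin NT → Fin Nt → ℂ => columns (scaledRadarMatrix (NR := NR) s) S := by
    refine continuous_matrix fun r Θ => ?_
    simp only [columns, scaledRadarMatrix, radarMatrix, Matrix.submatrix_apply, Matrix.smul_apply,
      Matrix.of_apply, modulate, circShift]
    fun_prop
  simp only [gramDeviation_eq_norm, gram]
  fun_prop

omit [NeZero NT] [NeZero NR] in
lemma receiverMatrix_signals (S : Finset (Grid NT NR Nt))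
    (x : (Fin NT × Fin Nt) × Fin 2 → ℝ) :
    receiverMatrix (signals x) S = synth (radarCoeff S) x := by
  rw [synth, gaussSum_realify]
  rfl

variable {Ω : Type*} [MeasurableSpace Ω] {P : Measure Ω} [IsProbabilityMeasure P]
  {s : Fin NT → Ω → Fin Nt → ℂ}

/-- The tail bound for a support set contained in one angle class. The moment method gives the
rate `δ / (4√ρ)` with the prefactor `card S ^ 2`. Whenever the claimed bound is nontrivial, half of
this rate compensates for one factor `card S`. -/
lemma measureReal_gramDeviation_le (hs : ∀ i, IsStdComplexGaussianVector (s i) P)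
    (hindep : iIndepFun s P) {S : Finset (Grid NT NR Nt)} (hne : S.Nonempty)
    (hS : ∀ Θ ∈ S, ∀ Θ' ∈ S, AngleEquiv Θ.1 Θ'.1) {δ : ℝ} (hδ : 0 < δ) (hδ1 : δ < 1) :
    P.real {ω | δ ≤ gramDeviation (fun i => s i ω) S}
      ≤ 7 * (S.card : ℝ) * Real.exp (-(δ * Real.sqrt Nt / (8 * Real.sqrt S.card))) := by
  have hNt : (0 : ℝ) < Nt := by exact_mod_cast NeZero.pos Nt
  have hK : (1 : ℝ) ≤ S.card := by exact_mod_cast hne.card_pos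
  set K : ℝ := (S.card : ℝ) with hKdef
  set E := Real.exp (-(δ * Real.sqrt Nt / (8 * Real.sqrt K))) with hE
  have hEpos : 0 < E := Real.exp_pos _
  by_cases htriv : 1 ≤ 7 * K * E
  · exact measureReal_le_one.trans htriv
  rw [not_le] at htriv
  have hsK : 0 < Real.sqrt K := Real.sqrt_pos.2 (by linarith)
  -- if `K > Nt` then the exponent is at least `-1/8` and the bound is trivial
  have hcard : K ≤ Nt := by
    by_contra hlt
    rw [not_le] at hlt
    have h1 : Real.sqrt Nt ≤ Real.sqrt K := Real.sqrt_le_sqrt hlt.le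
    have h2 : δ * Real.sqrt Nt / (8 * Real.sqrt K) ≤ 1 / 8 := by
      rw [div_le_iff₀ (by positivity)]
      nlinarith [Real.sqrt_nonneg (Nt : ℝ)]
    have h3 : 1 - 1 / 8 ≤ E := by
      have := Real.add_one_le_exp (-(δ * Real.sqrt Nt / (8 * Real.sqrt K)))
      rw [← hE] at this
      linarith
    nlinarith
  have hdisp := isDispersed_radarCoeff S hS hcard
  have hρ : 0 < K / Nt := by positivity
  have : Nonempty S := hne.coe_sort
  have htail := hdisp.measureReal_le hρ hδ
  have hset : {x | δ ≤ ‖(synth (radarCoeff S) x)ᴴ * synth (radarCoeff S) x - 1‖}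
      = signals ⁻¹' {t | δ ≤ gramDeviation t S} := by
    ext x
    simp only [Set.mem_preimage, Set.mem_ofPred_eq, gramDeviation_eq_norm,
      gram_eq_of_equiv _ hS, receiverMatrix_signals]
  have hmeas : MeasurableSet {t : Fin NT → Fin Nt → ℂ | δ ≤ gramDeviation t S} :=
    (isClosed_le continuous_const (continuous_gramDeviation S)).measurableSet
  have hlaw := hasLaw_signals hs hindep
  have hP : P.real {ω | δ ≤ gramDeviation (fun i => s i ω) S}
      = (gaussPi ((Fin NT × Fin Nt) × Fin 2) (1 / 2)).real
        {x | δ ≤ ‖(synth (radarCoeff S) x)ᴴ * synth (radarCoeff S) x - 1‖} := by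
    rw [hset, ← map_measureReal_apply measurable_signals hmeas, ← hlaw.map_eq,
      map_measureReal_apply_of_aemeasurable hlaw.aemeasurable hmeas]
    rfl
  rw [hP]
  refine htail.trans ?_
  have hexp : Real.exp (-(δ / (4 * Real.sqrt (K / Nt)))) = E * E := by
    rw [hE, ← Real.exp_add, Real.sqrt_div' _ hNt.le]
    congr 1
    have : 0 < Real.sqrt (Nt : ℝ) := Real.sqrt_pos.2 hNt
    field_simp
    ring
  -- `7 * K * E < 1`, so `K ^ 2 * E ^ 2` is at most `K * E / 7`
  rw [hexp, Fintype.card_coe, ← hKdef]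
  have h0 : 0 < K * E := by positivity
  nlinarith

omit [NeZero NT] [NeZero NR] [NeZero Nt] in
lemma classPart_eq_of_angleEquiv (S : Finset (Grid NT NR Nt)) {β β' : Fin (NT * NR)}
    (h : AngleEquiv β β') : classPart S β = classPart S β' := by
  ext Θ
  simp only [classPart, Finset.mem_filter]
  exact and_congr_right fun _ => ⟨fun h' => h.symm.trans h', fun h' => h.trans h'⟩

/-- The representative in `{0, …, NR - 1}` of an angle class. -/
def classRep (r : Fin NR) : Fin (NT * NR) :=
  ⟨r, r.2.trans_le (Nat.le_mul_of_pos_left _ (NeZero.pos NT))⟩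

lemma angleEquiv_classRep_iff (r : Fin NR) (β : Fin (NT * NR)) :
    AngleEquiv (classRep (NT := NT) r) β ↔ r = Fin.ofNat NR β := by
  rw [AngleEquiv, ← Int.modEq_iff_dvd, classRep, Fin.ext_iff]
  simp only [Fin.ofNat]
  rw [Int.natCast_modEq_iff, Nat.ModEq, Nat.mod_eq_of_lt r.2]

omit [NeZero Nt] in
lemma sum_card_classPart (S : Finset (Grid NT NR Nt)) :
    ∑ r : Fin NR, (classPart S (classRep r)).card = S.card := by
  rw [Finset.card_eq_sum_card_fiberwise (f := fun Θ : Grid NT NR Nt => Fin.ofNat NR (Θ.1 : ℕ))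
    (t := Finset.univ) (fun _ _ => by simp)]
  refine Finset.sum_congr rfl fun r _ => ?_
  congr 1
  ext Θ
  simp [classPart, angleEquiv_classRep_iff, eq_comm]

/-- Union bound over the `NR` angle classes. As the exponential factor is common and the classes
partition `S`, the prefactors add up to `7 * S.card`, and `η ≥ 1`. -/
lemma measureReal_gramDeviation_le_of_isBalanced (hs : ∀ i, IsStdComplexGaussianVector (s i) P)
    (hindep : iIndepFun s P) {S : Finset (Grid NT NR Nt)} {η δ : ℝ} (hη : IsBalanced S η)
    (hδ : 0 < δ) (hδ1 : δ < 1) :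
    P.real {ω | δ ≤ gramDeviation (fun i => s i ω) S}
      ≤ 7 * η * (S.card : ℝ)
        * Real.exp (-(δ * Real.sqrt ((Nt : ℝ) * NR) / (8 * Real.sqrt (η * S.card)))) := by
  have hNR : (0 : ℝ) < NR := by exact_mod_cast NeZero.pos NR
  -- for `S = ∅` every real number is admissible, and there is no least one
  have hSne : S.Nonempty := by
    by_contra hemp
    rw [Finset.not_nonempty_iff_eq_empty] at hemp
    subst hemp
    have := hη.2 (show η - 1 ∈ _ by intro β; simp [classPart])
    linarith
  have hScard : (1 : ℝ) ≤ S.card := by exact_mod_cast hSne.card_pos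
  have hsum : ∑ r : Fin NR, ((classPart S (classRep r)).card : ℝ) = S.card := by
    exact_mod_cast sum_card_classPart S
  have hη1 : 1 ≤ η := by
    have h1 : ∑ r : Fin NR, ((classPart S (classRep r)).card : ℝ)
        ≤ ∑ _r : Fin NR, η * ((S.card : ℝ) / NR) := Finset.sum_le_sum fun r _ => hη.1 _
    rw [hsum, Finset.sum_const, Finset.card_univ, Fintype.card_fin, nsmul_eq_mul,
      mul_left_comm, mul_div_cancel₀ _ hNR.ne'] at h1
    nlinarith
  set E := Real.exp (-(δ * Real.sqrt ((Nt : ℝ) * NR) / (8 * Real.sqrt (η * S.card)))) with hE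
  have hclass : ∀ r : Fin NR,
      P.real {ω | δ ≤ gramDeviation (fun i => s i ω) (classPart S (classRep r))}
        ≤ 7 * ((classPart S (classRep r)).card : ℝ) * E := by
    intro r
    rcases (classPart S (classRep (NT := NT) r)).eq_empty_or_nonempty with h0 | h0
    · have : {ω | δ ≤ gramDeviation (fun i => s i ω) (classPart S (classRep r))} = ∅ := by
        rw [Set.eq_empty_iff_forall_notMem]
        intro ω hω
        rw [h0, Set.mem_ofPred_eq, gramDeviation_eq_norm, norm_eq_zero_of_isEmpty] at hω
        linarith
      rw [this, h0]
      simp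
    · refine (measureReal_gramDeviation_le hs hindep h0 angleEquiv_of_mem_classPart hδ hδ1).trans ?_
      have hc : (0 : ℝ) < (classPart S (classRep (NT := NT) r)).card := by
        exact_mod_cast h0.card_pos
      refine mul_le_mul_of_nonneg_left (Real.exp_le_exp.2 (neg_le_neg ?_)) (by positivity)
      have hle : ((classPart S (classRep (NT := NT) r)).card : ℝ) ≤ η * S.card / NR := by
        rw [← mul_div_assoc']
        exact hη.1 _
      have hsq : Real.sqrt (classPart S (classRep (NT := NT) r)).card
          ≤ Real.sqrt (η * S.card) / Real.sqrt NR := by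
        rw [← Real.sqrt_div' _ hNR.le]
        exact Real.sqrt_le_sqrt hle
      have h1 : 0 < Real.sqrt (η * S.card) := Real.sqrt_pos.2 (by positivity)
      have h2 : 0 < Real.sqrt (NR : ℝ) := Real.sqrt_pos.2 hNR
      have h3 : 0 < Real.sqrt (classPart S (classRep (NT := NT) r)).card := Real.sqrt_pos.2 hc
      calc δ * Real.sqrt ((Nt : ℝ) * NR) / (8 * Real.sqrt (η * S.card))
          = δ * Real.sqrt Nt / (8 * (Real.sqrt (η * S.card) / Real.sqrt NR)) := by
            rw [Real.sqrt_mul (by positivity)]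
            field_simp
        _ ≤ _ := by gcongr
  have hsub : {ω | δ ≤ gramDeviation (fun i => s i ω) S}
      ⊆ ⋃ r : Fin NR, {ω | δ ≤ gramDeviation (fun i => s i ω) (classPart S (classRep r))} := by
    intro ω hω
    obtain ⟨β, hβ⟩ := exists_gramDeviation_le (fun i => s i ω) S
    refine Set.mem_iUnion.2 ⟨Fin.ofNat NR β, ?_⟩
    rw [Set.mem_ofPred_eq, classPart_eq_of_angleEquiv S ((angleEquiv_classRep_iff _ _).2 rfl)]
    exact le_trans hω hβ
  calc _ ≤ P.real (⋃ r : Fin NR,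
          {ω | δ ≤ gramDeviation (fun i => s i ω) (classPart S (classRep r))}) :=
        measureReal_mono hsub
    _ ≤ ∑ r : Fin NR, P.real
          {ω | δ ≤ gramDeviation (fun i => s i ω) (classPart S (classRep r))} :=
        measureReal_iUnion_fintype_le _
    _ ≤ ∑ r : Fin NR, 7 * ((classPart S (classRep r)).card : ℝ) * E :=
        Finset.sum_le_sum fun r _ => hclass r
    _ = 7 * (S.card : ℝ) * E := by rw [← Finset.sum_mul, ← Finset.mul_sum, hsum]
    _ ≤ _ := by
        have hE0 : 0 < E := Real.exp_pos _
        have : (S.card : ℝ) ≤ η * S.card := by nlinarith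
        rw [mul_assoc 7 η]
        gcongr

end Tail

end MimoRadar

end

theorem mainTheorem5 {NT NR Nt : ℕ} [NeZero NT] [NeZero NR] [NeZero Nt]
    {Ω : Type*} [MeasurableSpace Ω] (P : Measure Ω) [IsProbabilityMeasure P]
    (s : Fin NT → Ω → Fin Nt → ℂ)
    (hs : ∀ i, MimoRadar.IsStdComplexGaussianVector (s i) P)
    (hindep : iIndepFun s P) :
    -- the tail bound for a single angle class
    (∀ (S : Finset (MimoRadar.Grid NT NR Nt)) (β : Fin (NT * NR)) (δ : ℝ),
      (MimoRadar.classPart S β).Nonempty → 0 < δ → δ < 1 →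
      P.real {ω | δ ≤ MimoRadar.gramDeviation (fun i => s i ω) (MimoRadar.classPart S β)} ≤
        7 * ((MimoRadar.classPart S β).card : ℝ) *
          Real.exp (-(δ * Real.sqrt (Nt : ℝ) /
            (8 * Real.sqrt ((MimoRadar.classPart S β).card : ℝ))))) ∧
    -- the block-diagonal structure across angle classes
    (∀ (S : Finset (MimoRadar.Grid NT NR Nt)) (ω : Ω),
      (∀ Θ Θ' : S, ¬ MimoRadar.AngleEquiv Θ.1.1 Θ'.1.1 →
        MimoRadar.gram (fun i => s i ω) S Θ Θ' = 0) ∧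
      IsGreatest (Set.range fun β : Fin (NT * NR) =>
          MimoRadar.gramDeviation (fun i => s i ω) (MimoRadar.classPart S β))
        (MimoRadar.gramDeviation (fun i => s i ω) S)) ∧
    -- the conditioning bound for balanced support sets
    (∀ (S : Finset (MimoRadar.Grid NT NR Nt)) (η δ : ℝ),
      MimoRadar.IsBalanced S η → 0 < δ → δ < 1 →
      P.real {ω | δ ≤ MimoRadar.gramDeviation (fun i => s i ω) S} ≤
        7 * η * (S.card : ℝ) *
          Real.exp (-(δ * Real.sqrt ((Nt : ℝ) * (NR : ℝ)) /
            (8 * Real.sqrt (η * (S.card : ℝ)))))) := by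
  refine ⟨fun S β δ hne hδ hδ1 => ?_, fun S ω => ⟨fun Θ Θ' h => ?_, ?_, ?_⟩,
    fun S η δ hη hδ hδ1 => ?_⟩
  · exact MimoRadar.measureReal_gramDeviation_le hs hindep hne
      MimoRadar.angleEquiv_of_mem_classPart hδ hδ1
  · rw [MimoRadar.gram_apply, if_neg h]
  · obtain ⟨β, hβ⟩ := MimoRadar.exists_gramDeviation_le (fun i => s i ω) S
    exact ⟨β, le_antisymm (MimoRadar.gramDeviation_classPart_le _ S β) hβ⟩
  · rintro _ ⟨β, rfl⟩
    exact MimoRadar.gramDeviation_classPart_le _ S β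
  · exact MimoRadar.measureReal_gramDeviation_le_of_isBalanced hs hindep hη hδ hδ1
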